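/- **Theorem 5.1.** Let $n\in\{1,3\}$. Let $\alpha_0\in L^\infty(\mathbb R^n)$ satisfy $m_0^2\le\alpha_0(x)\le M_0^2$ for a.e. $x\in\mathbb R^n$ with positive constants $m_0,M_0$. Let $D\subset\mathbb R^n$ be a bounded open set (possibly empty) with Lipschitz boundary, $h\in L^\infty(D)$, and let $\alpha\in L^\infty(\mathbb R^n)$, with $\operatorname{ess\,inf}_{\mathbb R^n}\alpha>0$, be given by $\alpha=\alpha_0$ a.e. on $\mathbb R^n\setminus D$ and $\alpha=\alpha_0+h$ a.e. on $D$. Let $B$ be an open ball with $\overline B\cap\overline D=\emptyset$, let $f=\chi_B$ be its characteristic function, and let $\operatorname{dist}(D,B)=\inf\{|x-y|: x\in D,\ y\in B\}$. Consider the conditions * (A.I) there is $C>0$ with $h(x)\ge C$ for a.e. $x\in D$; * (A.II) there is $C>0$ with $-h(x)\ge C$ for a.e. $x\in D$. For $\beta\in L^\infty(\mathbb R^n)$ with $\operatorname{ess\,inf}\beta>0$ and $T>0$, the weak solution of $$\beta\,\partial_t^2u-\Delta u=0\ \text{ in }\mathbb R^n\times{]0,T[},\qquad u(\cdot,0)=0,\quad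 \partial_tu(\cdot,0)=f$$ is the function $u\in L^2(0,T;H^1(\mathbb R^n))$ with $u'\in L^2(0,T;L^2(\mathbb R^n))$ and $(\beta u')'\in L^2(0,T;H^1(\mathbb R^n)')$ such that for all $\phi\in H^1(\mathbb R^n)$ $$\langle(\beta u')'(t),\phi\rangle+\int_{\mathbb R^n}\nabla u(t)\cdot\nabla\phi\,dx=0\quad\text{for a.e. }t\in{]0,T[},$$ and such that $u(0)=0$ in $L^2(\mathbb R^n)$ and $(\beta u')(0)=\beta f$ in $H^1(\mathbb R^n)'$. Let $u$ be the weak solution for $\beta=\alpha$ (the medium with the obstacle), let $V$ be the weak solution for $\beta=\alpha_0$ (the same medium without the obstacle), both with initial velocity $f=\chi_B$, and let $V_e$ be the reference wave observed on $B$, that is, $V_e(t)=V(t)$ a.e. on $B$ for a.e. $t\in{]0,T[}$. For $\tau>0$ put $$w(x,\tau)=\int_0^Te^{-\tau t}u(x,t)\,dt,\qquad v_e(x,\tau)=\int_0^Te^{-\tau t}V_e(x,t)\,dt\ \ (x\in B),\qquad I(\tau)=\int_B\alpha_0f\,(w-v_e)\,dx .$$ (So $I(\tau)$ is determined by the waves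 observed on $B$ over $]0,T[$ and by $\alpha_0$ on $B$ only.) Then: (i) if $D=\emptyset$, then for all $T>0$, $\displaystyle\lim_{\tau\to\infty}e^{\tau T}I(\tau)=0$; (ii) if $D\ne\emptyset$ and $h$ satisfies (A.I), then for all $T>2M_0\operatorname{dist}(D,B)$, $\displaystyle\lim_{\tau\to\infty}e^{\tau T}I(\tau)=-\infty$; (iii) if $D\ne\emptyset$ and $h$ satisfies (A.II), then for all $T>2M_0\operatorname{dist}(D,B)$, $\displaystyle\lim_{\tau\to\infty}e^{\tau T}I(\tau)=\infty$. Moreover, in both cases (ii) and (iii), for all $T>2M_0\operatorname{dist}(D,B)$, $$\liminf_{\tau\to\infty}\frac1{2\tau}\log|I(\tau)|\ge-M_0\operatorname{dist}(D,B)\qquad\text{and}\qquad\limsup_{\tau\to\infty}\frac1{2\tau}\log|I(\tau)|\le-m_0\operatorname{dist}(D,B).$$ -/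

import Mathlib

open MeasureTheory Set Filter Topology
open scoped ENNReal NNReal ContDiff

noncomputable section

namespace RoughWave

/-- The Euclidean space of dimension `n`. -/
abbrev E (n : ℕ) : Type := EuclideanSpace ℝ (Fin n)

/-- The real Hilbert space `L²(ℝⁿ)`. -/
abbrev L2 (n : ℕ) : Type := Lp ℝ 2 (volume : Measure (E n))

/-- The Hilbert space of square integrable vector fields on `ℝⁿ`. -/
abbrev L2Vec (n : ℕ) : Type := Lp (E n) 2 (volume : Measure (E n))

/-- The space `L^∞(ℝⁿ)`. -/
abbrev LInf (n : ℕ) : Type := Lp ℝ ∞ (volume : Measure (E n))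

/-! ### The Sobolev space `H¹(ℝⁿ)` -/

/-- `G` is the weak gradient of `u`: for every test function `φ ∈ C_c^∞(ℝⁿ)` and every direction
`e`, `∫ u ∂_e φ = - ∫ φ (G · e)`. -/
def IsWeakGradient {n : ℕ} (u : E n → ℝ) (G : E n → E n) : Prop :=
  ∀ φ : E n → ℝ, ContDiff ℝ ∞ φ → HasCompactSupport φ → ∀ e : E n,
    ∫ x, u x * fderiv ℝ φ x e = - ∫ x, φ x * inner ℝ (G x) e

theorem memLp_test {n : ℕ} {φ : E n → ℝ} (hφ : Continuous φ) (hc : HasCompactSupport φ) :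
    MemLp φ 2 (volume : Measure (E n)) :=
  hφ.memLp_of_hasCompactSupport hc

theorem memLp_test_fderiv {n : ℕ} {φ : E n → ℝ} (hφ : ContDiff ℝ ∞ φ) (hc : HasCompactSupport φ)
    (e : E n) : MemLp (fun x => fderiv ℝ φ x e) 2 (volume : Measure (E n)) := by
  refine memLp_test ((hφ.continuous_fderiv (by simp)).clm_apply continuous_const) ?_
  exact hc.fderiv_apply (𝕜 := ℝ) e

theorem integrable_left {n : ℕ} (u : L2 n) {φ : E n → ℝ} (hφ : ContDiff ℝ ∞ φ)
    (hc : HasCompactSupport φ) (e : E n) :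
    Integrable (fun x => u x * fderiv ℝ φ x e) (volume : Measure (E n)) :=
  (Lp.memLp u).integrable_mul (memLp_test_fderiv hφ hc e)

theorem integrable_right {n : ℕ} (G : L2Vec n) {φ : E n → ℝ} (hφ : ContDiff ℝ ∞ φ)
    (hc : HasCompactSupport φ) (e : E n) :
    Integrable (fun x => φ x * inner ℝ (G x) e) (volume : Measure (E n)) :=
  (memLp_test hφ.continuous hc).integrable_mul ((Lp.memLp G).inner_const e)

/-- The Sobolev space `H¹(ℝⁿ)`, realised as the space of the pairs `(u, ∇u)`, where `u ∈ L²(ℝⁿ)`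
has the weak gradient `∇u ∈ L²(ℝⁿ; ℝⁿ)` (which `u` determines).  The inner product inherited from
`L²(ℝⁿ) × L²(ℝⁿ; ℝⁿ)` is the usual one, `∫ u v + ∫ ∇u · ∇v`. -/
def H1 (n : ℕ) : Submodule ℝ (WithLp 2 (L2 n × L2Vec n)) where
  carrier := {z | IsWeakGradient (z.fst : E n → ℝ) (z.snd : E n → E n)}
  zero_mem' := by
    intro φ hφ hc e
    have h1 : (fun x => ((0 : WithLp 2 (L2 n × L2Vec n)).fst : E n → ℝ) x * fderiv ℝ φ x e)
        =ᵐ[volume] 0 := by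
      filter_upwards with x
      simp
    have h2 : (fun x => φ x * inner ℝ (((0 : WithLp 2 (L2 n × L2Vec n)).snd : E n → E n) x) e)
        =ᵐ[volume] 0 := by
      filter_upwards with x
      simp
    rw [integral_congr_ae h1, integral_congr_ae h2]
    simp
  add_mem' := by
    intro a b ha hb φ hφ hc e
    have h1 : (fun x => ((a + b).fst : E n → ℝ) x * fderiv ℝ φ x e) =ᵐ[volume]
        fun x => (a.fst : E n → ℝ) x * fderiv ℝ φ x e + (b.fst : E n → ℝ) x * fderiv ℝ φ x e := by
      filter_upwards [Lp.coeFn_add a.fst b.fst] with x hx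
      rw [WithLp.add_fst, hx, Pi.add_apply, add_mul]
    have h2 : (fun x => φ x * inner ℝ (((a + b).snd : E n → E n) x) e) =ᵐ[volume]
        fun x => φ x * inner ℝ ((a.snd : E n → E n) x) e
          + φ x * inner ℝ ((b.snd : E n → E n) x) e := by
      filter_upwards [Lp.coeFn_add a.snd b.snd] with x hx
      rw [WithLp.add_snd, hx, Pi.add_apply, inner_add_left, mul_add]
    rw [integral_congr_ae h1, integral_congr_ae h2,
      integral_add (integrable_left _ hφ hc e) (integrable_left _ hφ hc e),
      integral_add (integrable_right _ hφ hc e) (integrable_right _ hφ hc e),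
      ha φ hφ hc e, hb φ hφ hc e, neg_add]
  smul_mem' := by
    intro c a ha φ hφ hc e
    have h1 : (fun x => ((c • a).fst : E n → ℝ) x * fderiv ℝ φ x e) =ᵐ[volume]
        fun x => c * ((a.fst : E n → ℝ) x * fderiv ℝ φ x e) := by
      filter_upwards [Lp.coeFn_smul c a.fst] with x hx
      rw [WithLp.smul_fst, hx, Pi.smul_apply, smul_eq_mul, mul_assoc]
    have h2 : (fun x => φ x * inner ℝ (((c • a).snd : E n → E n) x) e) =ᵐ[volume]
        fun x => c * (φ x * inner ℝ ((a.snd : E n → E n) x) e) := by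
      filter_upwards [Lp.coeFn_smul c a.snd] with x hx
      rw [WithLp.smul_snd, hx, Pi.smul_apply, real_inner_smul_left]
      ring
    rw [integral_congr_ae h1, integral_congr_ae h2, integral_const_mul, integral_const_mul,
      ha φ hφ hc e, mul_neg]

/-- The function in `L²(ℝⁿ)` underlying an element of `H¹(ℝⁿ)`. -/
def toL2 {n : ℕ} (u : H1 n) : L2 n := (u : WithLp 2 (L2 n × L2Vec n)).fst

/-- The weak gradient of an element of `H¹(ℝⁿ)`. -/
def grad {n : ℕ} (u : H1 n) : L2Vec n := (u : WithLp 2 (L2 n × L2Vec n)).snd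

/-- The Dirichlet form `a(u, φ) = ∫ ∇u · ∇φ` on `H¹(ℝⁿ)`. -/
def dirichletForm {n : ℕ} (u φ : H1 n) : ℝ := inner ℝ (grad u) (grad φ)

/-- The dual space `H¹(ℝⁿ)'`. -/
abbrev H1Dual (n : ℕ) : Type := StrongDual ℝ (H1 n)

/-- The embedding of `L²(ℝⁿ)` into the dual of `H¹(ℝⁿ)`: `g` is identified with the functional
`φ ↦ ∫ g φ`. -/
def toH1Dual {n : ℕ} (g : L2 n) : H1Dual n :=
  (innerSL ℝ g).comp ((WithLp.fstL 2 ℝ (L2 n) (L2Vec n)).comp (H1 n).subtypeL)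

/-! ### Functions of time with values in a Banach space -/

section Time

variable {X : Type*} [NormedAddCommGroup X] [NormedSpace ℝ X]

/-- `u ∈ L²(0, T; X)`. -/
def IsL2Time (T : ℝ) (u : ℝ → X) : Prop := MemLp u 2 (volume.restrict (Ioo 0 T))

/-- `u' = du/dt` on `]0, T[` in the sense of `X`-valued distributions. -/
def HasWeakTimeDeriv (T : ℝ) (u u' : ℝ → X) : Prop :=
  ∀ ψ : ℝ → ℝ, ContDiff ℝ ∞ ψ → HasCompactSupport ψ → tsupport ψ ⊆ Ioo 0 T →
    ∫ t in Ioo 0 T, deriv ψ t • u t = - ∫ t in Ioo 0 T, ψ t • u' t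

/-- `u(0) = x₀`, in the sense that `u` agrees a.e. on `]0, T[` with a continuous function on
`[0, T]` whose value at `0` is `x₀`. -/
def HasInitialValue (T : ℝ) (u : ℝ → X) (x₀ : X) : Prop :=
  ∃ c : ℝ → X, ContinuousOn c (Icc 0 T) ∧ c 0 = x₀ ∧ ∀ᵐ t ∂(volume.restrict (Ioo 0 T)), u t = c t

/-- The Laplace transform over the finite time interval `]0, T[`: `∫₀ᵀ e^{-τ t} u(t) dt`. -/
def finiteLaplace (T τ : ℝ) (u : ℝ → X) : X := ∫ t in Ioo 0 T, Real.exp (-τ * t) • u t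

end Time

/-! ### The wave equation -/

/-- `u` is the weak solution on `]0, T[` of `α ∂ₜ²u - Δu = 0` with `u(0) = 0` and `∂ₜu(0) = f`:
`u ∈ L²(0, T; H¹)`, `u' ∈ L²(0, T; L²)`, `(α u')' ∈ L²(0, T; (H¹)')`, and for every `φ ∈ H¹`,
`⟨(α u')'(t), φ⟩ + ∫ ∇u(t) · ∇φ = 0` for a.e. `t`.  The initial velocity is attained by `α u'` in
`(H¹)'`, where this function is continuous. -/
def IsWeakSolution {n : ℕ} (α : LInf n) (f : L2 n) (T : ℝ) (u : ℝ → H1 n) : Prop :=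
  IsL2Time T u ∧
  ∃ (u' : ℝ → L2 n) (g : ℝ → H1Dual n),
    IsL2Time T u' ∧ HasWeakTimeDeriv T (fun t => toL2 (u t)) u' ∧
    IsL2Time T g ∧ HasWeakTimeDeriv T (fun t => toH1Dual (α • u' t : L2 n)) g ∧
    (∀ φ : H1 n, ∀ᵐ t ∂(volume.restrict (Ioo 0 T)), g t φ + dirichletForm (u t) φ = 0) ∧
    HasInitialValue T (fun t => toL2 (u t)) 0 ∧
    HasInitialValue T (fun t => toH1Dual (α • u' t : L2 n)) (toH1Dual (α • f : L2 n))

/-! ### The obstacle and the ball -/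

/-- The boundary of `D` is Lipschitz: near each of its points, `D` is the region above the graph
of a Lipschitz function over the hyperplane orthogonal to some unit vector `e`. -/
def HasLipschitzBoundary {n : ℕ} (D : Set (E n)) : Prop :=
  ∀ z ∈ frontier D, ∃ e : E n, ‖e‖ = 1 ∧ ∃ (K : ℝ≥0) (γ : E n → ℝ), LipschitzWith K γ ∧
    ∀ᶠ x in 𝓝 z, (x ∈ D ↔ γ (x - inner ℝ e x • e) < inner ℝ e x)

/-- The distance `inf {|x - y| : x ∈ D, y ∈ B}` between two sets. -/
def setDist {n : ℕ} (D B : Set (E n)) : ℝ := sInf (Set.image2 dist D B)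

/-- The characteristic function of the ball with centre `p` and radius `η`, in `L²(ℝⁿ)`. -/
def ballIndicator {n : ℕ} (p : E n) (η : ℝ) : L2 n :=
  indicatorConstLp 2 (measurableSet_ball (x := p) (ε := η)) measure_ball_lt_top.ne (1 : ℝ)

/-- The space `L²(B)` for the ball `B` with centre `p` and radius `η`. -/
abbrev L2Ball {n : ℕ} (p : E n) (η : ℝ) : Type :=
  Lp ℝ 2 ((volume : Measure (E n)).restrict (Metric.ball p η))

/-- `Ve` is the reference wave observed on the ball `B` over the time interval `]0, T[`: it is the
restriction to `B` of the weak solution for the medium `α₀` with initial velocity `χ_B`. -/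
def IsReferenceWave {n : ℕ} (α₀ : LInf n) (p : E n) (η T : ℝ) (Ve : ℝ → L2Ball p η) : Prop :=
  ∃ V : ℝ → H1 n, IsWeakSolution α₀ (ballIndicator p η) T V ∧
    ∀ᵐ t ∂(volume.restrict (Ioo 0 T)),
      (Ve t : E n → ℝ) =ᵐ[volume.restrict (Metric.ball p η)] (toL2 (V t) : E n → ℝ)

/-- The indicator function `τ ↦ ∫_B α₀ f (w - v_e) dx` with `f = χ_B`,
`w(τ) = ∫₀ᵀ e^{-τ t} u(t) dt` and `v_e(τ) = ∫₀ᵀ e^{-τ t} V_e(t) dt`. -/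
def indicatorFunction {n : ℕ} (α₀ : LInf n) (p : E n) (η T : ℝ) (u : ℝ → H1 n)
    (Ve : ℝ → L2Ball p η) (τ : ℝ) : ℝ :=
  ∫ x in Metric.ball p η, α₀ x * ballIndicator p η x *
    ((finiteLaplace T τ (fun t => toL2 (u t)) : L2 n) x - (finiteLaplace T τ Ve : L2Ball p η) x)

end RoughWave

end

open RoughWave

/-! Integrating the wave equation against `e^{-τt}` over `]0,T[` turns it into the stationary
equation `-Δw + τ²αw = αχ_B`, up to end-point terms at `t = T` that carry the factor `e^{-τT}`
(`IsWeakSolution.exists_laplace`). From here on let `w` and `v` be the exact solutions of the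
stationary problems for `α` and `α₀`. Since `B` misses `D`, both have the source `α₀χ_B`. The energy
forms are symmetric, so testing the transformed wave equations with `w` and `v` themselves gives
`e^{τT}(I - J) → 0`, where `J = ∫ α₀χ_B (w - v)` (`tendsto_exp_mul_indicatorFunction_sub`). It
remains to study `J`.

Let `E_β` denote the energy `∫ |∇·|² + τ²∫ β|·|²`. Expanding the energy of `w - v` gives the two
identities `J = E_α(w - v) - τ²∫_D (α - α₀)v²` and `J = -E_{α₀}(w - v) - τ²∫_D (α - α₀)w²`. Hence
`J` has the sign opposite to that of the jump `α - α₀` on `D`, and `|J|` is comparable with `τ²∫_D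
v²` (`le_inner_of_le_neg`, `inner_le_of_le`, `abs_inner_le`).

The size of `v` on `D` comes from comparison, since a rough `α₀` admits no explicit fundamental
solution. The weak maximum principle (`nonneg_of_energyForm_nonneg`) compares `v` with multiples of
`exp(-kρ)`, `ρ` a regularised distance to a point. For `k = τm₀`, centred at the centre of `B`, this
is a supersolution as soon as `n ≥ 1`; for `k = τκ` with `κ > M₀`, centred at a point of `B` almost
closest to `D`, it is a subsolution when `τ` is large. So, for large `τ`, `τ²∫_D v²` lies between
`e^{-2τ(M₀d + ε)}` and `e^{-2τ(m₀d - ε)}`, where `d = dist(D, B)` and `ε > 0` is arbitrary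
(`eventually_le_mass`, `eventually_mass_le`). The condition `T > 2M₀d` is exactly what lets `J`
dominate the error `o(e^{-τT})`.

The maximum principle needs the negative part of an `H¹` function as a test function. It is obtained
from `L²` difference quotients along translations, which also yield integration by parts for weak
derivatives. -/

noncomputable section

namespace RoughWave

/-! ### Weak time derivatives of vector-valued functions and the finite Laplace transform -/

section TimeDerivative

variable {X : Type*} [NormedAddCommGroup X] [NormedSpace ℝ X]

theorem deriv_smoothTransition_eq_zero {x : ℝ} (hx : x ∉ Icc (0 : ℝ) 1) :
    deriv Real.smoothTransition x = 0 := by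
  rw [mem_Icc, not_and_or, not_le, not_le] at hx
  rcases hx with hx | hx
  · have : Real.smoothTransition =ᶠ[𝓝 x] fun _ => 0 := by
      filter_upwards [Iio_mem_nhds hx] with y hy
      exact Real.smoothTransition.zero_of_nonpos hy.le
    rw [this.deriv_eq, deriv_const]
  · have : Real.smoothTransition =ᶠ[𝓝 x] fun _ => 1 := by
      filter_upwards [Ioi_mem_nhds hx] with y hy
      exact Real.smoothTransition.one_of_one_le (le_of_lt hy)
    rw [this.deriv_eq, deriv_const]

theorem continuous_deriv_smoothTransition : Continuous (deriv Real.smoothTransition) :=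
  (Real.smoothTransition.contDiff (n := 1)).continuous_deriv le_rfl

theorem hasCompactSupport_deriv_smoothTransition :
    HasCompactSupport (deriv Real.smoothTransition) :=
  HasCompactSupport.intro isCompact_Icc fun _ hx => deriv_smoothTransition_eq_zero hx

theorem integrable_deriv_smoothTransition : Integrable (deriv Real.smoothTransition) :=
  continuous_deriv_smoothTransition.integrable_of_hasCompactSupport
    hasCompactSupport_deriv_smoothTransition

theorem integral_deriv_smoothTransition : ∫ s, deriv Real.smoothTransition s = 1 := by
  have h0 : Tendsto Real.smoothTransition atBot (𝓝 0) := by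
    refine tendsto_const_nhds.congr' ?_
    filter_upwards [eventually_le_atBot (0 : ℝ)] with x hx
    exact (Real.smoothTransition.zero_of_nonpos hx).symm
  have h1 : Tendsto Real.smoothTransition atTop (𝓝 1) := by
    refine tendsto_const_nhds.congr' ?_
    filter_upwards [eventually_ge_atTop (1 : ℝ)] with x hx
    exact (Real.smoothTransition.one_of_one_le hx).symm
  rw [integral_of_hasDerivAt_of_tendsto
    (fun x => ((Real.smoothTransition.contDiff (n := 1)).differentiable one_ne_zero x).hasDerivAt)
    integrable_deriv_smoothTransition h0 h1, sub_zero]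

/-- The masses `N b'(N t - 1) dt` concentrate at `0`. -/
theorem tendsto_integral_smoothTransition [CompleteSpace X] {P : ℝ → X} (hP : Continuous P)
    {M : ℝ} (hM : ∀ t, ‖P t‖ ≤ M) :
    Tendsto (fun N : ℕ => ∫ t, ((N : ℝ) * deriv Real.smoothTransition (N * t - 1)) • P t) atTop
      (𝓝 (P 0)) := by
  have key : ∀ N : ℕ, 0 < N →
      ∫ t, ((N : ℝ) * deriv Real.smoothTransition (N * t - 1)) • P t
        = ∫ s, deriv Real.smoothTransition s • P ((s + 1) / N) := by
    intro N hN
    have hN' : (0 : ℝ) < N := by exact_mod_cast hN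
    have h1 := Measure.integral_comp_mul_left
      (fun s => deriv Real.smoothTransition (s - 1) • P (s / N)) (N : ℝ)
    have h2 := integral_sub_right_eq_self (μ := volume)
      (fun s => deriv Real.smoothTransition s • P ((s + 1) / N)) (1 : ℝ)
    rw [← h2]
    simp only [sub_add_cancel]
    have h3 : ∀ t : ℝ, (N : ℝ) * t / N = t := fun t => by field_simp
    simp only [h3] at h1
    simp only [mul_smul]
    rw [integral_smul, h1, abs_of_pos (inv_pos.2 hN'), smul_smul, mul_inv_cancel₀ hN'.ne', one_smul]
  have hlim : Tendsto (fun N : ℕ => ∫ s, deriv Real.smoothTransition s • P ((s + 1) / N)) atTop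
      (𝓝 (∫ s, deriv Real.smoothTransition s • P 0)) := by
    refine tendsto_integral_of_dominated_convergence
      (fun s => |deriv Real.smoothTransition s| * M) ?_ ?_ ?_ ?_
    · intro N
      exact (continuous_deriv_smoothTransition.smul
        (hP.comp (by fun_prop))).aestronglyMeasurable
    · exact integrable_deriv_smoothTransition.abs.mul_const M
    · intro N
      refine Eventually.of_forall fun s => ?_
      rw [norm_smul, Real.norm_eq_abs]
      exact mul_le_mul_of_nonneg_left (hM _) (abs_nonneg _)
    · refine Eventually.of_forall fun s => ?_
      refine tendsto_const_nhds.smul ((hP.tendsto 0).comp ?_)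
      exact tendsto_const_nhds.div_atTop tendsto_natCast_atTop_atTop
  rw [integral_smul_const, integral_deriv_smoothTransition, one_smul] at hlim
  refine hlim.congr' ?_
  filter_upwards [eventually_gt_atTop 0] with N hN
  exact (key N hN).symm

/-- A smooth cutoff function on `]0, T[`. -/
def timeCutoff (T : ℝ) (N : ℕ) (t : ℝ) : ℝ :=
  Real.smoothTransition (N * t - 1) + Real.smoothTransition (N * (T - t) - 1) - 1

theorem contDiff_timeCutoff (T : ℝ) (N : ℕ) : ContDiff ℝ ∞ (timeCutoff T N) := by
  unfold timeCutoff
  have h := Real.smoothTransition.contDiff (n := (⊤ : ℕ∞))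
  exact ((h.comp (by fun_prop)).add (h.comp (by fun_prop))).sub contDiff_const

theorem deriv_timeCutoff (T : ℝ) (N : ℕ) (t : ℝ) :
    deriv (timeCutoff T N) t = N * deriv Real.smoothTransition (N * t - 1)
      - N * deriv Real.smoothTransition (N * (T - t) - 1) := by
  have hd : ∀ x, HasDerivAt Real.smoothTransition (deriv Real.smoothTransition x) x := fun x =>
    ((Real.smoothTransition.contDiff (n := 1)).differentiable one_ne_zero x).hasDerivAt
  have h1 : HasDerivAt (fun t : ℝ => (N : ℝ) * t - 1) N t := by
    simpa using ((hasDerivAt_id t).const_mul (N : ℝ)).sub_const 1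
  have h2 : HasDerivAt (fun t : ℝ => (N : ℝ) * (T - t) - 1) (-N) t := by
    simpa using (((hasDerivAt_id t).const_sub T).const_mul (N : ℝ)).sub_const 1
  have h3 := (((hd _).comp t h1).add ((hd _).comp t h2)).sub_const 1
  rw [show timeCutoff T N = fun t => ((Real.smoothTransition ∘ fun t : ℝ => (N : ℝ) * t - 1)
    + Real.smoothTransition ∘ fun t : ℝ => (N : ℝ) * (T - t) - 1) t - 1 from rfl, h3.deriv]
  ring

/-- The ramps occupy `[1/N, 2/N]` and `[T - 2/N, T - 1/N]`. For `N T ≥ 4` they do not overlap, so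
where one transition still vanishes the other is already `1`, and subtracting `1` leaves zero. -/
theorem timeCutoff_eq_zero {T : ℝ} {N : ℕ} (hN : 4 ≤ N * T) {t : ℝ}
    (ht : N * t ≤ 1 ∨ N * (T - t) ≤ 1) : timeCutoff T N t = 0 := by
  unfold timeCutoff
  rcases ht with ht | ht
  · rw [Real.smoothTransition.zero_of_nonpos (by linarith),
      Real.smoothTransition.one_of_one_le (by linarith)]
    ring
  · rw [Real.smoothTransition.one_of_one_le (by linarith),
      Real.smoothTransition.zero_of_nonpos (x := N * (T - t) - 1) (by linarith)]
    ring

theorem tsupport_timeCutoff_subset {T : ℝ} (hT : 0 < T) {N : ℕ} (hN : 4 ≤ N * T) :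
    tsupport (timeCutoff T N) ⊆ Icc (1 / N : ℝ) (T - 1 / N) := by
  have hN0 : (0 : ℝ) < N := by
    by_contra hcon
    nlinarith
  refine closure_minimal (fun t ht => ?_) isClosed_Icc
  by_contra hcon
  refine ht (timeCutoff_eq_zero hN ?_)
  rw [mem_Icc, not_and_or, not_le, not_le] at hcon
  refine hcon.imp (fun h => ?_) (fun h => ?_)
  · rw [lt_div_iff₀ hN0] at h
    linarith
  · have : T - t < 1 / N := by linarith
    rw [lt_div_iff₀ hN0] at this
    linarith

theorem abs_timeCutoff_le (T : ℝ) (N : ℕ) (t : ℝ) : |timeCutoff T N t| ≤ 1 := by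
  unfold timeCutoff
  rw [abs_le]
  constructor <;>
  linarith [Real.smoothTransition.nonneg (N * t - 1), Real.smoothTransition.nonneg (N * (T - t) - 1),
    Real.smoothTransition.le_one (N * t - 1), Real.smoothTransition.le_one (N * (T - t) - 1)]

theorem tendsto_timeCutoff {T t : ℝ} (ht : t ∈ Ioo 0 T) :
    Tendsto (fun N : ℕ => timeCutoff T N t) atTop (𝓝 1) := by
  have h : ∀ s : ℝ, 0 < s → ∀ᶠ N : ℕ in atTop, (2 : ℝ) ≤ N * s := fun s hs =>
    (tendsto_natCast_atTop_atTop.atTop_mul_const hs).eventually_ge_atTop 2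
  refine tendsto_const_nhds.congr' ?_
  filter_upwards [h t ht.1, h (T - t) (sub_pos.2 ht.2)] with N h1 h2
  unfold timeCutoff
  rw [Real.smoothTransition.one_of_one_le (by linarith),
    Real.smoothTransition.one_of_one_le (by linarith)]
  ring

/-- The fundamental theorem of calculus for weak derivatives. -/
theorem HasWeakTimeDeriv.integral_eq_sub [CompleteSpace X] {T : ℝ} (hT : 0 < T) {v q P : ℝ → X}
    (hv : HasWeakTimeDeriv T v q) (hP : ContinuousOn P (Icc 0 T))
    (hvP : ∀ᵐ t ∂(volume.restrict (Ioo 0 T)), v t = P t) (hq : IntegrableOn q (Ioo 0 T)) :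
    ∫ t in Ioo 0 T, q t = P T - P 0 := by
  -- Constant extension of `P` beyond `[0, T]`: a bounded continuous function on the whole line, as
  -- the concentration lemma requires at both end points.
  set Q : ℝ → X := IccExtend hT.le (domRestrict (Icc 0 T) P) with hQ
  have hQc : Continuous Q := hP.domRestrict.Icc_extend'
  have hQP : ∀ t ∈ Icc 0 T, Q t = P t := fun t ht => by
    rw [hQ, IccExtend_of_mem _ _ ht, domRestrict_apply]
  obtain ⟨M, hM⟩ : ∃ M, ∀ t, ‖Q t‖ ≤ M := by
    obtain ⟨M, hM⟩ := isCompact_Icc.exists_bound_of_continuousOn hP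
    refine ⟨M, fun t => ?_⟩
    rw [hQ, IccExtend, Function.comp_apply, domRestrict_apply]
    exact hM _ (Subtype.coe_prop _)
  have hNT : ∀ᶠ N : ℕ in atTop, (4 : ℝ) ≤ N * T :=
    (tendsto_natCast_atTop_atTop.atTop_mul_const hT).eventually_ge_atTop 4
  have hN0 : ∀ᶠ N : ℕ in atTop, 0 < N := eventually_gt_atTop 0
  have hL : Tendsto (fun N : ℕ => ∫ t in Ioo 0 T, timeCutoff T N t • q t) atTop
      (𝓝 (∫ t in Ioo 0 T, q t)) := by
    refine tendsto_integral_of_dominated_convergence (fun t => ‖q t‖) ?_ hq.norm ?_ ?_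
    · intro N
      exact (contDiff_timeCutoff T N).continuous.aestronglyMeasurable.smul hq.aestronglyMeasurable
    · intro N
      refine Eventually.of_forall fun t => ?_
      rw [norm_smul, Real.norm_eq_abs]
      exact mul_le_of_le_one_left (norm_nonneg _) (abs_timeCutoff_le T N t)
    · filter_upwards [ae_restrict_mem measurableSet_Ioo] with t ht
      simpa using (tendsto_timeCutoff ht).smul_const (q t)
  have hR1 := tendsto_integral_smoothTransition hQc hM
  -- The reflection `t ↦ T - t` turns concentration at `0` into concentration at `T`.
  have hR2 := tendsto_integral_smoothTransition (P := fun t => Q (T - t))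
    (hQc.comp (by fun_prop)) fun t => hM _
  simp only [sub_zero] at hR2
  have hint : ∀ N : ℕ, 0 < N →
      Integrable fun t => ((N : ℝ) * deriv Real.smoothTransition (N * t - 1)) • Q t := by
    intro N hN
    have hN' : (0 : ℝ) < N := by exact_mod_cast hN
    refine Continuous.integrable_of_hasCompactSupport ?_ ?_
    · exact (continuous_const.mul
        (continuous_deriv_smoothTransition.comp (by fun_prop))).smul hQc
    · refine HasCompactSupport.intro (isCompact_Icc (a := 1 / (N : ℝ)) (b := 2 / N)) fun t ht => ?_
      rw [deriv_smoothTransition_eq_zero, mul_zero, zero_smul]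
      intro h
      refine ht ⟨?_, ?_⟩
      · rw [div_le_iff₀ hN']
        linarith [h.1]
      · rw [le_div_iff₀ hN']
        linarith [h.2]
  have hint' : ∀ N : ℕ, 0 < N →
      Integrable fun t => ((N : ℝ) * deriv Real.smoothTransition (N * (T - t) - 1)) • Q t := by
    intro N hN
    have hN' : (0 : ℝ) < N := by exact_mod_cast hN
    refine Continuous.integrable_of_hasCompactSupport ?_ ?_
    · exact (continuous_const.mul
        (continuous_deriv_smoothTransition.comp (by fun_prop))).smul hQc
    · refine HasCompactSupport.intro (isCompact_Icc (a := T - 2 / (N : ℝ)) (b := T - 1 / N))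
        fun t ht => ?_
      rw [deriv_smoothTransition_eq_zero, mul_zero, zero_smul]
      intro h
      refine ht ⟨?_, ?_⟩
      · rw [sub_le_comm, le_div_iff₀ hN']
        linarith [h.2]
      · rw [le_sub_comm, div_le_iff₀ hN']
        linarith [h.1]
  have hR : Tendsto (fun N : ℕ => -∫ t in Ioo 0 T, deriv (timeCutoff T N) t • v t) atTop
      (𝓝 (Q T - Q 0)) := by
    refine (hR2.sub hR1).congr' ?_
    filter_upwards [hNT, hN0] with N h4 hN
    have e1 : ∫ t in Ioo 0 T, deriv (timeCutoff T N) t • v t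
        = ∫ t, deriv (timeCutoff T N) t • Q t := by
      refine Eq.trans ?_ (setIntegral_eq_integral_of_forall_compl_eq_zero (s := Ioo 0 T) ?_)
      · refine integral_congr_ae ?_
        filter_upwards [hvP, ae_restrict_mem measurableSet_Ioo] with t h1 h2
        rw [h1, hQP t (Ioo_subset_Icc_self h2)]
      · intro t ht
        have hN' : (0 : ℝ) < N := by exact_mod_cast hN
        have : t ∉ tsupport (timeCutoff T N) := fun h => by
          have := tsupport_timeCutoff_subset hT h4 h
          have h5 : (0 : ℝ) < 1 / N := by positivity
          exact ht ⟨by linarith [this.1], by linarith [this.2]⟩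
        rw [image_eq_zero_of_notMem_tsupport (fun h => this (tsupport_deriv_subset h)), zero_smul]
    have e2 : ∫ t, ((N : ℝ) * deriv Real.smoothTransition (N * t - 1)) • Q (T - t)
        = ∫ t, ((N : ℝ) * deriv Real.smoothTransition (N * (T - t) - 1)) • Q t := by
      rw [← integral_sub_left_eq_self _ volume T]
      simp only [sub_sub_cancel]
    rw [e1, e2, ← integral_sub (hint' N hN) (hint N hN), ← integral_neg]
    refine integral_congr_ae (Eventually.of_forall fun t => ?_)
    simp only [deriv_timeCutoff]
    rw [← sub_smul, ← neg_smul, neg_sub]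
  have hE : ∀ᶠ N : ℕ in atTop, -∫ t in Ioo 0 T, deriv (timeCutoff T N) t • v t
      = ∫ t in Ioo 0 T, timeCutoff T N t • q t := by
    filter_upwards [hNT, hN0] with N h4 hN
    have hN' : (0 : ℝ) < N := by exact_mod_cast hN
    have hs := tsupport_timeCutoff_subset hT h4
    rw [hv _ (contDiff_timeCutoff T N) (isCompact_Icc.of_isClosed_subset (isClosed_tsupport _) hs)
      (hs.trans fun t ht => ?_), neg_neg]
    have h5 : (0 : ℝ) < 1 / N := by positivity
    exact ⟨by linarith [ht.1], by linarith [ht.2]⟩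
  rw [← hQP T (right_mem_Icc.2 hT.le), ← hQP 0 (left_mem_Icc.2 hT.le)]
  exact tendsto_nhds_unique hL (hR.congr' hE)

theorem IsL2Time.integrableOn {X : Type*} [NormedAddCommGroup X] {T : ℝ} {u : ℝ → X} (hu : IsL2Time T u) :
    IntegrableOn u (Ioo 0 T) :=
  MemLp.integrable one_le_two hu

theorem integrableOn_exp_smul {T : ℝ} (τ : ℝ) {u : ℝ → X} (hu : IntegrableOn u (Ioo 0 T)) :
    IntegrableOn (fun t => Real.exp (-τ * t) • u t) (Ioo 0 T) := by
  have hc : Continuous fun t : ℝ => Real.exp (-τ * t) := by fun_prop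
  obtain ⟨C, hC⟩ := (isCompact_Icc (a := (0 : ℝ)) (b := T)).exists_bound_of_continuousOn
    hc.continuousOn
  refine Integrable.bdd_smul hu C hc.aestronglyMeasurable ?_
  filter_upwards [ae_restrict_mem measurableSet_Ioo] with t ht
  exact hC t (Ioo_subset_Icc_self ht)

/-- Integration by parts in the Laplace transform. -/
theorem HasWeakTimeDeriv.finiteLaplace_eq [CompleteSpace X] {T : ℝ} (hT : 0 < T) {v q P : ℝ → X}
    (hv : HasWeakTimeDeriv T v q) (hP : ContinuousOn P (Icc 0 T))
    (hvP : ∀ᵐ t ∂(volume.restrict (Ioo 0 T)), v t = P t) (hvi : IntegrableOn v (Ioo 0 T))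
    (hq : IntegrableOn q (Ioo 0 T)) (τ : ℝ) :
    finiteLaplace T τ q = Real.exp (-τ * T) • P T - P 0 + τ • finiteLaplace T τ v := by
  have hw : HasWeakTimeDeriv T (fun t => Real.exp (-τ * t) • v t)
      (fun t => Real.exp (-τ * t) • q t - τ • Real.exp (-τ * t) • v t) := by
    intro ψ hψ hc hs
    have hexp : ContDiff ℝ ∞ fun t : ℝ => Real.exp (-τ * t) := by fun_prop
    -- The exponential is absorbed into the test function, so only the product rule for smooth
    -- scalar functions is needed.
    have h1 := hv (fun t => ψ t * Real.exp (-τ * t)) (hψ.mul hexp) hc.mul_right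
      ((tsupport_mul_subset_left).trans hs)
    have hd : ∀ t, deriv (fun t => ψ t * Real.exp (-τ * t)) t
        = deriv ψ t * Real.exp (-τ * t) - τ * (ψ t * Real.exp (-τ * t)) := by
      intro t
      have h2 : HasDerivAt (fun t : ℝ => Real.exp (-τ * t)) (Real.exp (-τ * t) * (-τ)) t := by
        simpa using ((hasDerivAt_id t).const_mul (-τ)).exp
      have h3 := ((hψ.differentiable (by simp) t).hasDerivAt).mul h2
      rw [show (fun t => ψ t * Real.exp (-τ * t)) = ψ * fun t => Real.exp (-τ * t) from rfl, h3.deriv]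
      ring
    obtain ⟨C, hC⟩ := hψ.continuous.bounded_above_of_compact_support hc
    obtain ⟨C', hC'⟩ := (hψ.continuous_deriv (by simp)).bounded_above_of_compact_support
      (hc.deriv)
    have i1 : IntegrableOn (fun t => deriv ψ t • Real.exp (-τ * t) • v t) (Ioo 0 T) :=
      Integrable.bdd_smul (integrableOn_exp_smul τ hvi) C'
        (hψ.continuous_deriv (by simp)).aestronglyMeasurable (Eventually.of_forall hC')
    have i2 : IntegrableOn (fun t => ψ t • Real.exp (-τ * t) • v t) (Ioo 0 T) :=
      Integrable.bdd_smul (integrableOn_exp_smul τ hvi) C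
        hψ.continuous.aestronglyMeasurable (Eventually.of_forall hC)
    have i3 : IntegrableOn (fun t => ψ t • Real.exp (-τ * t) • q t) (Ioo 0 T) :=
      Integrable.bdd_smul (integrableOn_exp_smul τ hq) C
        hψ.continuous.aestronglyMeasurable (Eventually.of_forall hC)
    have e1 : ∫ t in Ioo 0 T, deriv (fun t => ψ t * Real.exp (-τ * t)) t • v t
        = (∫ t in Ioo 0 T, deriv ψ t • Real.exp (-τ * t) • v t)
          - τ • ∫ t in Ioo 0 T, ψ t • Real.exp (-τ * t) • v t := by
      rw [← integral_smul, ← integral_sub i1 (by exact i2.smul τ)]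
      refine integral_congr_ae (Eventually.of_forall fun t => ?_)
      simp only [hd, sub_smul, mul_smul]
    have e2 : ∫ t in Ioo 0 T, ψ t • (Real.exp (-τ * t) • q t - τ • Real.exp (-τ * t) • v t)
        = (∫ t in Ioo 0 T, ψ t • Real.exp (-τ * t) • q t)
          - τ • ∫ t in Ioo 0 T, ψ t • Real.exp (-τ * t) • v t := by
      rw [← integral_smul, ← integral_sub i3 (by exact i2.smul τ)]
      refine integral_congr_ae (Eventually.of_forall fun t => ?_)
      simp only [smul_sub]
      rw [smul_comm (ψ t) τ]
    have e3 : ∫ t in Ioo 0 T, (ψ t * Real.exp (-τ * t)) • q t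
        = ∫ t in Ioo 0 T, ψ t • Real.exp (-τ * t) • q t := by
      simp only [mul_smul]
    rw [e1, e3] at h1
    simp only [e2]
    rw [neg_sub, ← neg_add_eq_sub, ← h1]
    abel
  have hc : ContinuousOn (fun t => Real.exp (-τ * t) • P t) (Icc 0 T) :=
    (by fun_prop : Continuous fun t : ℝ => Real.exp (-τ * t)).continuousOn.smul hP
  have h := hw.integral_eq_sub hT hc (by filter_upwards [hvP] with t ht; rw [ht])
    ((integrableOn_exp_smul τ hq).sub ((integrableOn_exp_smul τ hvi).smul τ))
  rw [integral_sub (integrableOn_exp_smul τ hq)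
    (by exact (integrableOn_exp_smul τ hvi).smul τ), integral_smul] at h
  unfold finiteLaplace
  simp only [mul_zero, Real.exp_zero, one_smul] at h
  exact sub_eq_iff_eq_add.1 h

theorem finiteLaplace_comp_clm {Y : Type*} [NormedAddCommGroup Y] [NormedSpace ℝ Y]
    [CompleteSpace X] [CompleteSpace Y] (L : X →L[ℝ] Y) {T : ℝ} {u : ℝ → X}
    (hu : IntegrableOn u (Ioo 0 T)) (τ : ℝ) :
    finiteLaplace T τ (fun t => L (u t)) = L (finiteLaplace T τ u) := by
  unfold finiteLaplace
  rw [← L.integral_comp_comm (integrableOn_exp_smul τ hu)]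
  simp only [map_smul]

theorem finiteLaplace_congr {T τ : ℝ} {u v : ℝ → X}
    (h : ∀ᵐ t ∂(volume.restrict (Ioo 0 T)), u t = v t) :
    finiteLaplace T τ u = finiteLaplace T τ v :=
  integral_congr_ae (by filter_upwards [h] with t ht; rw [ht])

end TimeDerivative

/-! ### Translations and weak partial derivatives -/

section Partial

variable {n : ℕ}

theorem inner_eq_integral (u v : L2 n) : inner ℝ u v = ∫ x, u x * v x := by
  rw [L2.inner_def]
  refine integral_congr_ae (Eventually.of_forall fun x => ?_)
  simp only [RCLike.inner_apply, conj_trivial]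
  ring

theorem integrable_mul_L2 (u v : L2 n) : Integrable (fun x => u x * v x) :=
  (Lp.memLp u).integrable_mul (Lp.memLp v)

/-- The translate `x ↦ u (x + h)` of a function in `L²(ℝⁿ)`. -/
def shift (h : E n) (u : L2 n) : L2 n :=
  Lp.compMeasurePreserving (fun x => x + h) (measurePreserving_add_right volume h) u

theorem coeFn_shift (h : E n) (u : L2 n) : shift h u =ᵐ[volume] fun x => u (x + h) :=
  Lp.coeFn_compMeasurePreserving u (measurePreserving_add_right volume h)

theorem shift_zero (u : L2 n) : shift 0 u = u := by
  refine Lp.ext ?_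
  filter_upwards [coeFn_shift 0 u] with x hx
  rw [hx, add_zero]

theorem continuous_shift (e : E n) (u : L2 n) : Continuous fun t : ℝ => shift (t • e) u := by
  refine Continuous.compMeasurePreservingLp (f := fun _ : ℝ => u)
    (g := fun t : ℝ => (⟨fun x => x + t • e, by fun_prop⟩ : C(E n, E n)))
    continuous_const ?_ (fun t => measurePreserving_add_right volume (t • e)) (by simp)
  exact ContinuousMap.continuous_of_continuous_uncurry _ (by
    change Continuous fun p : ℝ × E n => p.2 + p.1 • e
    fun_prop)

theorem inner_shift_left (h : E n) (u : L2 n) {φ : E n → ℝ} (hφ : MemLp φ 2) :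
    inner ℝ (shift h u) (hφ.toLp φ) = ∫ x, u x * φ (x - h) := by
  rw [inner_eq_integral, ← integral_add_right_eq_self (fun x => u x * φ (x - h)) h]
  refine integral_congr_ae ?_
  filter_upwards [coeFn_shift h u, hφ.coeFn_toLp] with x h1 h2
  rw [h1, h2, add_sub_cancel_right]

/-- `u` has the weak derivative `g` in the direction `e`. -/
def IsWeakPartial (e : E n) (u g : L2 n) : Prop :=
  ∀ φ : E n → ℝ, ContDiff ℝ ∞ φ → HasCompactSupport φ →
    ∫ x, u x * fderiv ℝ φ x e = - ∫ x, φ x * g x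

/-- The derivative falls on the smooth factor, so `u` needs no regularity. For `|t - t₀| < 1` the
translated supports stay in one fixed ball, which gives an integrable majorant. -/
theorem hasDerivAt_integral_translate (u : L2 n) {φ : E n → ℝ} (hφ : ContDiff ℝ ∞ φ)
    (hc : HasCompactSupport φ) (e : E n) (t₀ : ℝ) :
    HasDerivAt (fun t : ℝ => ∫ x, u x * φ (x - t • e))
      (∫ x, u x * -fderiv ℝ φ (x - t₀ • e) e) t₀ := by
  have hdc : Continuous fun x => fderiv ℝ φ x e :=
    (hφ.continuous_fderiv (by simp)).clm_apply continuous_const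
  have hdcs : HasCompactSupport fun x => fderiv ℝ φ x e := hc.fderiv_apply (𝕜 := ℝ) e
  obtain ⟨C, hC⟩ := hdc.bounded_above_of_compact_support hdcs
  obtain ⟨R, hR⟩ := hdcs.isCompact.isBounded.subset_closedBall 0
  -- The radius covers the support of the derivative, moved by `t • e` with `|t| ≤ |t₀| + 1`.
  set S : Set (E n) := Metric.closedBall 0 (R + (|t₀| + 1) * ‖e‖) with hS
  have hmem : ∀ t : ℝ, MemLp (fun x => φ (x - t • e)) 2 (volume : Measure (E n)) := fun t =>
    (memLp_test hφ.continuous hc).comp_measurePreserving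
      (measurePreserving_sub_right volume (t • e))
  refine (hasDerivAt_integral_of_dominated_loc_of_deriv_le
    (F := fun t x => u x * φ (x - t • e)) (F' := fun t x => u x * -fderiv ℝ φ (x - t • e) e)
    (bound := fun x => |u x| * S.indicator (fun _ => C) x)
    (Metric.ball_mem_nhds t₀ one_pos) ?_ ?_ ?_ ?_ ?_ ?_).2
  · exact Eventually.of_forall fun t =>
      ((Lp.memLp u).integrable_mul (hmem t)).aestronglyMeasurable
  · exact (Lp.memLp u).integrable_mul (hmem t₀)
  · refine (Lp.aestronglyMeasurable u).mul (Continuous.aestronglyMeasurable ?_)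
    exact (hdc.comp (continuous_id.sub continuous_const)).neg
  · refine Eventually.of_forall fun x t ht => ?_
    rw [norm_mul, norm_neg, Real.norm_eq_abs (u x)]
    refine mul_le_mul_of_nonneg_left ?_ (abs_nonneg _)
    by_cases hx : x ∈ S
    · rw [indicator_of_mem hx]
      exact hC _
    · rw [indicator_of_notMem hx, norm_le_zero_iff]
      by_contra hne
      have h1 : x - t • e ∈ Metric.closedBall (0 : E n) R :=
        hR (subset_tsupport _ hne)
      refine hx ?_
      rw [hS, mem_closedBall_zero_iff]
      rw [mem_closedBall_zero_iff] at h1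
      have h2 : |t| ≤ |t₀| + 1 := by
        rw [Metric.mem_ball, Real.dist_eq] at ht
        linarith [abs_sub_abs_le_abs_sub t t₀]
      calc ‖x‖ = ‖(x - t • e) + t • e‖ := by rw [sub_add_cancel]
        _ ≤ ‖x - t • e‖ + ‖t • e‖ := norm_add_le _ _
        _ ≤ R + (|t₀| + 1) * ‖e‖ := by
          rw [norm_smul, Real.norm_eq_abs]
          exact add_le_add h1 (mul_le_mul_of_nonneg_right h2 (norm_nonneg _))
  · refine (Lp.memLp u).integrable_mul (q := 2) (g := S.indicator (fun _ => C)) ?_ |>.norm.congr ?_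
    · exact memLp_indicator_const 2 measurableSet_closedBall C
        (Or.inr (measure_closedBall_lt_top).ne)
    · refine Eventually.of_forall fun x => ?_
      have : 0 ≤ S.indicator (fun _ => C) x :=
        indicator_nonneg (fun x _ => (norm_nonneg _).trans (hC x)) x
      simp only [norm_mul, Real.norm_eq_abs, Pi.mul_apply, abs_of_nonneg this]
  · refine Eventually.of_forall fun x t _ => ?_
    have h1 : HasDerivAt (fun t : ℝ => x - t • e) (-((1 : ℝ) • e)) t :=
      ((hasDerivAt_id t).smul_const e).const_sub x
    have h2 := (hφ.differentiable (by simp) (x - t • e)).hasFDerivAt.comp_hasDerivAt t h1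
    have h3 := h2.const_mul (u x)
    simpa using h3

/-- Testing the weak derivative with the translates of `φ` says that the translation orbit of `u` is
weakly differentiable at every time `t`, with derivative the orbit of `g`. -/
theorem IsWeakPartial.hasDerivAt_inner_shift {e : E n} {u g : L2 n} (hg : IsWeakPartial e u g)
    {φ : E n → ℝ} (hφ : ContDiff ℝ ∞ φ) (hc : HasCompactSupport φ) (hm : MemLp φ 2) (t : ℝ) :
    HasDerivAt (fun t : ℝ => inner ℝ (shift (t • e) u) (hm.toLp φ))
      (inner ℝ (shift (t • e) g) (hm.toLp φ)) t := by
  simp only [inner_shift_left]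
  convert! hasDerivAt_integral_translate u hφ hc e t using 1
  have h := hg (fun x => φ (x - t • e)) (hφ.comp (contDiff_id.sub contDiff_const))
    (hc.comp_homeomorph (Homeomorph.subRight (t • e)))
  simp only [fderiv_comp_sub] at h
  simp only [mul_neg, integral_neg, h, neg_neg]
  exact integral_congr_ae (Eventually.of_forall fun x => mul_comm _ _)

/-- A vector of `L²(ℝⁿ)` orthogonal to the test functions vanishes. -/
theorem eq_of_inner_test {a b : L2 n}
    (h : ∀ (φ : E n → ℝ) (_ : ContDiff ℝ ∞ φ) (_ : HasCompactSupport φ) (hm : MemLp φ 2),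
      inner ℝ a (hm.toLp φ) = inner ℝ b (hm.toLp φ)) : a = b := by
  have hd := Lp.dense_hasCompactSupport_contDiff (F := ℝ) (μ := (volume : Measure (E n)))
    (p := 2) (by simp)
  refine hd.eq_of_inner_left (𝕜 := ℝ) ?_
  rintro f ⟨g, hfg, hgc, hg⟩
  have hm := memLp_test hg.continuous hgc
  have : f = hm.toLp g := Lp.ext (hfg.trans hm.coeFn_toLp.symm)
  rw [this]
  exact h g hg hgc hm

/-- Paired with a test function, this is the scalar fundamental theorem of calculus; density of test
functions lifts it to `L²`. Since translations act continuously on `L²`, the right side is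
differentiable in norm, which upgrades weak to strong convergence of difference quotients. -/
theorem IsWeakPartial.shift_sub {e : E n} {u g : L2 n} (hg : IsWeakPartial e u g) (t : ℝ) :
    shift (t • e) u - u = ∫ s in (0 : ℝ)..t, shift (s • e) g := by
  refine eq_of_inner_test fun φ hφ hc hm => ?_
  have hI : IntervalIntegrable (fun s : ℝ => shift (s • e) g) volume 0 t :=
    (continuous_shift e g).intervalIntegrable _ _
  have h1 := (innerSL ℝ (hm.toLp φ)).intervalIntegral_comp_comm hI
  simp only [innerSL_apply_apply] at h1
  rw [real_inner_comm _ (intervalIntegral _ _ _ _), ← h1]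
  have h2 := intervalIntegral.integral_eq_sub_of_hasDerivAt (a := 0) (b := t)
    (fun s _ => hg.hasDerivAt_inner_shift hφ hc hm s)
    (((continuous_shift e g).inner continuous_const).intervalIntegrable _ _)
  simp only [zero_smul, shift_zero] at h2
  rw [inner_sub_left, ← h2]
  exact intervalIntegral.integral_congr fun s _ => real_inner_comm _ _

theorem norm_shift (h : E n) (u : L2 n) : ‖shift h u‖ = ‖u‖ :=
  Lp.norm_compMeasurePreserving u _

theorem IsWeakPartial.norm_shift_sub_le {e : E n} {u g : L2 n} (hg : IsWeakPartial e u g) (t : ℝ) :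
    ‖shift (t • e) u - u‖ ≤ ‖g‖ * |t| := by
  rw [hg.shift_sub]
  have := intervalIntegral.norm_integral_le_of_norm_le_const (a := 0) (b := t)
    (f := fun s : ℝ => shift (s • e) g) (C := ‖g‖) fun s _ => (norm_shift _ g).le
  simpa using this

/-- The difference quotients of `u` converge to its weak derivative in `L²(ℝⁿ)`. -/
theorem IsWeakPartial.hasDerivAt_shift {e : E n} {u g : L2 n} (hg : IsWeakPartial e u g) :
    HasDerivAt (fun t : ℝ => shift (t • e) u) g 0 := by
  have h1 : HasDerivAt (fun t : ℝ => ∫ s in (0 : ℝ)..t, shift (s • e) g)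
      (shift ((0 : ℝ) • e) g) 0 :=
    intervalIntegral.integral_hasDerivAt_right ((continuous_shift e g).intervalIntegrable _ _)
      ((continuous_shift e g).stronglyMeasurableAtFilter _ _) (continuous_shift e g).continuousAt
  rw [zero_smul, shift_zero] at h1
  simp only [← hg.shift_sub] at h1
  simpa using h1.add_const u

theorem IsWeakPartial.tendsto_slope {e : E n} {u g : L2 n} (hg : IsWeakPartial e u g) :
    Tendsto (fun t : ℝ => t⁻¹ • (shift (t • e) u - u)) (𝓝[≠] 0) (𝓝 g) := by
  have h := hasDerivAt_iff_tendsto_slope.1 hg.hasDerivAt_shift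
  refine h.congr fun t => ?_
  simp [slope, shift_zero]

theorem inner_shift_neg (h : E n) (u v : L2 n) :
    inner ℝ (shift h u) v = inner ℝ u (shift (-h) v) := by
  rw [inner_eq_integral, inner_eq_integral,
    ← integral_add_right_eq_self (fun x => u x * shift (-h) v x) h]
  have h2 := (measurePreserving_add_right (volume : Measure (E n)) h).quasiMeasurePreserving.ae
    (coeFn_shift (-h) v)
  refine integral_congr_ae ?_
  filter_upwards [coeFn_shift h u, h2] with x hx hx2
  rw [hx, hx2, add_neg_cancel_right]

/-- Integration by parts for weak derivatives. -/
theorem IsWeakPartial.inner_eq_neg {e : E n} {u g v k : L2 n} (hu : IsWeakPartial e u g)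
    (hv : IsWeakPartial e v k) : inner ℝ g v = -inner ℝ u k := by
  -- The function `t ↦ ⟨u(· + te), v⟩` is differentiated at `0` in two ways, with the translation on
  -- `u` and then, inverted, on `v`; no approximation by smooth functions is involved.
  have h1 : HasDerivAt (fun t : ℝ => inner ℝ (shift (t • e) u) v) (inner ℝ g v) 0 := by
    simpa using hu.hasDerivAt_shift.inner ℝ (hasDerivAt_const (0 : ℝ) v)
  have h2 : HasDerivAt (fun t : ℝ => shift (-t • e) v) (-k) 0 := by
    have hv' : HasDerivAt (fun t : ℝ => shift (t • e) v) k (-(0 : ℝ)) := by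
      rw [neg_zero]
      exact hv.hasDerivAt_shift
    have := hv'.scomp (0 : ℝ) (hasDerivAt_neg (0 : ℝ))
    simpa [Function.comp_def] using this
  have h3 : HasDerivAt (fun t : ℝ => inner ℝ u (shift (-t • e) v)) (-inner ℝ u k) 0 := by
    simpa using (hasDerivAt_const (0 : ℝ) u).inner ℝ h2
  simp only [inner_shift_neg, ← neg_smul] at h1
  exact h1.unique h3

/-- Functions with bounded difference quotients have a weak derivative. -/
theorem exists_isWeakPartial {e : E n} {u : L2 n} {C : ℝ}
    (h : ∀ t : ℝ, ‖shift (t • e) u - u‖ ≤ C * |t|) : ∃ g, IsWeakPartial e u g := by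
  set F : ℝ → WeakDual ℝ (L2 n) := fun t =>
    StrongDual.toWeakDual (innerSL ℝ (t⁻¹ • (shift (t • e) u - u))) with hF
  have hC : 0 ≤ C := by simpa using (norm_nonneg _).trans (h 1)
  -- Banach–Alaoglu: the difference quotients, viewed as functionals, stay in a weak-* compact ball.
  -- An ultrafilter finer than the punctured neighbourhoods of `0` replaces the choice of a
  -- convergent subsequence.
  have hK := WeakDual.isCompact_closedBall (𝕜 := ℝ) (0 : StrongDual ℝ (L2 n)) C
  obtain ⟨U, hU⟩ : ∃ U : Ultrafilter ℝ, (U : Filter ℝ) ≤ 𝓝[≠] 0 := Ultrafilter.exists_le _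
  have hmem : ∀ t, F t ∈ WeakDual.toStrongDual ⁻¹' Metric.closedBall (0 : StrongDual ℝ (L2 n)) C := by
    intro t
    rw [mem_preimage, mem_closedBall_zero_iff]
    change ‖innerSL ℝ (t⁻¹ • (shift (t • e) u - u))‖ ≤ C
    rw [innerSL_apply_norm, norm_smul, norm_inv, Real.norm_eq_abs]
    -- At `t = 0` the convention `0⁻¹ = 0` makes the quotient vanish.
    rcases eq_or_ne t 0 with rfl | ht
    · simpa using hC
    · rw [inv_mul_le_iff₀ (abs_pos.2 ht), mul_comm]
      exact h t
  obtain ⟨G, -, hG⟩ := isCompact_iff_ultrafilter_le_nhds.1 hK (U.map F)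
    (le_principal_iff.2 (mem_map.2 (Filter.univ_mem' hmem)))
  refine ⟨(InnerProductSpace.toDual ℝ (L2 n)).symm (WeakDual.toStrongDual G),
    fun φ hφ hc => ?_⟩
  have hm := memLp_test hφ.continuous hc
  have h1 : Tendsto (fun t => F t (hm.toLp φ)) U (𝓝 (G (hm.toLp φ))) :=
    ((WeakDual.eval_continuous (hm.toLp φ)).tendsto G).comp hG
  have h2 : Tendsto (fun t => F t (hm.toLp φ)) (𝓝[≠] 0)
      (𝓝 (∫ x, u x * -fderiv ℝ φ (x - (0 : ℝ) • e) e)) := by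
    refine (hasDerivAt_iff_tendsto_slope.1 (hasDerivAt_integral_translate u hφ hc e 0)).congr
      fun t => ?_
    change _ = inner ℝ (t⁻¹ • (shift (t • e) u - u)) (hm.toLp φ)
    rw [real_inner_smul_left, inner_sub_left, slope, vsub_eq_sub, smul_eq_mul, sub_zero,
      ← inner_shift_left _ _ hm, ← inner_shift_left _ _ hm, zero_smul, shift_zero]
  have h3 := tendsto_nhds_unique h1 (h2.mono_left hU)
  have h4 : inner ℝ ((InnerProductSpace.toDual ℝ (L2 n)).symm (WeakDual.toStrongDual G))
      (hm.toLp φ) = G (hm.toLp φ) := by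
    rw [InnerProductSpace.toDual_symm_apply]
    rfl
  rw [← h4, inner_eq_integral] at h3
  simp only [zero_smul, sub_zero, mul_neg, integral_neg] at h3
  rw [← neg_eq_iff_eq_neg, ← h3]
  refine integral_congr_ae ?_
  filter_upwards [hm.coeFn_toLp] with x hx
  rw [hx, mul_comm]

end Partial

/-! ### The Sobolev space and the Dirichlet form -/

section Sobolev

variable {n : ℕ}

/-- The embedding of `H¹(ℝⁿ)` into `L²(ℝⁿ)`. -/
def toL2L (n : ℕ) : H1 n →L[ℝ] L2 n :=
  (WithLp.fstL 2 ℝ (L2 n) (L2Vec n)).comp (H1 n).subtypeL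

/-- The weak gradient as a continuous linear map. -/
def gradL (n : ℕ) : H1 n →L[ℝ] L2Vec n :=
  (WithLp.sndL 2 ℝ (L2 n) (L2Vec n)).comp (H1 n).subtypeL

theorem toL2_sub (u v : H1 n) : toL2 (u - v) = toL2 u - toL2 v := map_sub (toL2L n) u v

theorem toL2_smul (c : ℝ) (u : H1 n) : toL2 (c • u) = c • toL2 u := map_smul (toL2L n) c u

theorem norm_sq_H1 (u : H1 n) : ‖u‖ ^ 2 = ‖toL2 u‖ ^ 2 + ‖grad u‖ ^ 2 :=
  WithLp.prod_norm_sq_eq_of_L2 (u : WithLp 2 (L2 n × L2Vec n))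

/-- The derivative of `u ∈ H¹(ℝⁿ)` in the direction `e`. -/
def dirDeriv (u : H1 n) (e : E n) : L2 n :=
  ((Lp.memLp (grad u)).inner_const e).toLp _

theorem coeFn_dirDeriv (u : H1 n) (e : E n) :
    dirDeriv u e =ᵐ[volume] fun x => inner ℝ (grad u x) e :=
  MemLp.coeFn_toLp _

theorem isWeakPartial_dirDeriv (u : H1 n) (e : E n) :
    IsWeakPartial e (toL2 u) (dirDeriv u e) := by
  intro φ hφ hc
  have h := u.2 φ hφ hc e
  rw [show (∫ x, toL2 u x * fderiv ℝ φ x e) = _ from h]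
  congr 1
  refine integral_congr_ae ?_
  filter_upwards [coeFn_dirDeriv u e] with x hx
  rw [hx]
  rfl

/-- Pointwise Parseval in the standard basis. It reduces the vector gradient to scalar directional
derivatives, for which translations are available. -/
theorem dirichletForm_eq_sum (u φ : H1 n) :
    dirichletForm u φ = ∑ i, inner ℝ (dirDeriv u (EuclideanSpace.basisFun (Fin n) ℝ i))
      (dirDeriv φ (EuclideanSpace.basisFun (Fin n) ℝ i)) := by
  unfold dirichletForm
  rw [L2.inner_def]
  simp only [inner_eq_integral]
  rw [← integral_finsetSum _ fun i _ => integrable_mul_L2 _ _]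
  refine integral_congr_ae ?_
  have h1 : ∀ᵐ x, ∀ i, dirDeriv u (EuclideanSpace.basisFun (Fin n) ℝ i) x =
      inner ℝ (grad u x) (EuclideanSpace.basisFun (Fin n) ℝ i) :=
    ae_all_iff.2 fun i => coeFn_dirDeriv u _
  have h2 : ∀ᵐ x, ∀ i, dirDeriv φ (EuclideanSpace.basisFun (Fin n) ℝ i) x =
      inner ℝ (grad φ x) (EuclideanSpace.basisFun (Fin n) ℝ i) :=
    ae_all_iff.2 fun i => coeFn_dirDeriv φ _
  filter_upwards [h1, h2] with x h3 h4
  rw [← (EuclideanSpace.basisFun (Fin n) ℝ).sum_inner_mul_inner]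
  refine Finset.sum_congr rfl fun i _ => ?_
  rw [h3, h4, real_inner_comm (grad φ x)]

/-- A function whose partial derivatives are in `L²(ℝⁿ)` is in `H¹(ℝⁿ)`. -/
theorem exists_H1_of_isWeakPartial (u : L2 n) (g : Fin n → L2 n)
    (h : ∀ i, IsWeakPartial (EuclideanSpace.basisFun (Fin n) ℝ i) u (g i)) :
    ∃ z : H1 n, toL2 z = u ∧ ∀ i, dirDeriv z (EuclideanSpace.basisFun (Fin n) ℝ i) = g i := by
  set b := EuclideanSpace.basisFun (Fin n) ℝ with hb
  have hm : MemLp (fun x => ∑ i, g i x • b i) 2 (volume : Measure (E n)) := by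
    refine memLp_finsetSum _ fun i _ => ?_
    exact (ContinuousLinearMap.toSpanSingleton ℝ (b i)).comp_memLp' (Lp.memLp (g i))
  have hG : ∀ᵐ x, ∀ e : E n, inner ℝ (hm.toLp _ x) e = ∑ i, g i x * inner ℝ (b i) e := by
    filter_upwards [hm.coeFn_toLp] with x hx e
    rw [hx, sum_inner]
    simp only [real_inner_smul_left]
  have hw : IsWeakGradient (u : E n → ℝ) (hm.toLp _ : E n → E n) := by
    intro φ hφ hc e
    have h1 : ∀ x, fderiv ℝ φ x e = ∑ i, inner ℝ (b i) e * fderiv ℝ φ x (b i) := by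
      intro x
      conv_lhs => rw [← b.sum_repr' e]
      simp [map_sum]
    have h2 : ∀ i, Integrable (fun x => u x * fderiv ℝ φ x (b i)) := fun i =>
      integrable_left u hφ hc (b i)
    have h3 : ∀ i, Integrable (fun x => φ x * g i x) := fun i =>
      (memLp_test hφ.continuous hc).integrable_mul (Lp.memLp (g i))
    calc ∫ x, u x * fderiv ℝ φ x e
        = ∫ x, ∑ i, inner ℝ (b i) e * (u x * fderiv ℝ φ x (b i)) := by
          refine integral_congr_ae (Eventually.of_forall fun x => ?_)
          simp only [h1, Finset.mul_sum]
          exact Finset.sum_congr rfl fun i _ => by ring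
      _ = ∑ i, inner ℝ (b i) e * -∫ x, φ x * g i x := by
          rw [integral_finsetSum _ fun i _ => (h2 i).const_mul _]
          refine Finset.sum_congr rfl fun i _ => ?_
          rw [integral_const_mul, h i φ hφ hc]
      _ = -∫ x, ∑ i, inner ℝ (b i) e * (φ x * g i x) := by
          rw [integral_finsetSum _ fun i _ => (h3 i).const_mul _, ← Finset.sum_neg_distrib]
          refine Finset.sum_congr rfl fun i _ => ?_
          rw [integral_const_mul, mul_neg]
      _ = _ := by
          congr 1
          refine integral_congr_ae ?_
          filter_upwards [hG] with x hx
          rw [hx, Finset.mul_sum]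
          exact Finset.sum_congr rfl fun i _ => by ring
  refine ⟨⟨WithLp.toLp 2 (u, hm.toLp _), hw⟩, rfl, fun i => Lp.ext ?_⟩
  filter_upwards [coeFn_dirDeriv ⟨WithLp.toLp 2 (u, hm.toLp _), hw⟩ (b i), hG] with x h1 h2
  rw [h1]
  refine (h2 (b i)).trans ?_
  simp only [OrthonormalBasis.inner_eq_ite, mul_ite, mul_one, mul_zero]
  simp

/-- For fixed `φ` and `e`, both sides of the defining identity are `L²` inner products against fixed
vectors, hence continuous. The resulting completeness is what Lax–Milgram needs. -/
theorem isClosed_H1 (n : ℕ) : IsClosed (H1 n : Set (WithLp 2 (L2 n × L2Vec n))) := by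
  have h : (H1 n : Set (WithLp 2 (L2 n × L2Vec n))) =
      {z | ∀ φ : E n → ℝ, ContDiff ℝ ∞ φ → HasCompactSupport φ → ∀ e : E n,
        ∫ x, z.fst x * fderiv ℝ φ x e = - ∫ x, φ x * inner ℝ (z.snd x) e} := rfl
  rw [h]
  simp only [ofPred_forall]
  refine isClosed_iInter fun φ => isClosed_iInter fun hφ => isClosed_iInter fun hc =>
    isClosed_iInter fun e => ?_
  have hm1 := memLp_test_fderiv hφ hc e
  have hm2 : MemLp (fun x => φ x • e) 2 (volume : Measure (E n)) :=
    
    (ContinuousLinearMap.toSpanSingleton ℝ e).comp_memLp' (memLp_test hφ.continuous hc)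
  have h1 : ∀ z : WithLp 2 (L2 n × L2Vec n), ∫ x, z.fst x * fderiv ℝ φ x e
      = inner ℝ (WithLp.fstL 2 ℝ (L2 n) (L2Vec n) z) (hm1.toLp _) := by
    intro z
    rw [inner_eq_integral]
    refine integral_congr_ae ?_
    filter_upwards [hm1.coeFn_toLp] with x hx
    rw [hx]
    rfl
  have h2 : ∀ z : WithLp 2 (L2 n × L2Vec n), ∫ x, φ x * inner ℝ (z.snd x) e
      = inner ℝ (WithLp.sndL 2 ℝ (L2 n) (L2Vec n) z) (hm2.toLp _) := by
    intro z
    rw [L2.inner_def]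
    refine integral_congr_ae ?_
    filter_upwards [hm2.coeFn_toLp] with x hx
    rw [hx, inner_smul_right]
    rfl
  simp only [h1, h2]
  exact isClosed_eq (by fun_prop) (by fun_prop)

instance : CompleteSpace (H1 n) := (isClosed_H1 n).completeSpace_coe

/-- The negative part of a function in `H¹(ℝⁿ)` is in `H¹(ℝⁿ)`. -/
theorem exists_negPart (z : H1 n) : ∃ m : H1 n,
    (∀ᵐ x, toL2 m x = max (-toL2 z x) 0) ∧ dirichletForm z m ≤ 0 := by
  set b := EuclideanSpace.basisFun (Fin n) ℝ with hb
  set v : L2 n := (-toL2 z) ⊔ 0 with hv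
  have hvx : ∀ᵐ x, v x = max (-toL2 z x) 0 := by
    filter_upwards [Lp.coeFn_sup (-toL2 z) 0, Lp.coeFn_neg (toL2 z),
      Lp.coeFn_zero ℝ 2 (volume : Measure (E n))] with x h1 h2 h3
    rw [hv, h1, Pi.sup_apply, h2, h3]
    rfl
  have hsh : ∀ h : E n, ∀ᵐ x, (shift h (toL2 z) - toL2 z) x = toL2 z (x + h) - toL2 z x ∧
      (shift h v - v) x = max (-toL2 z (x + h)) 0 - max (-toL2 z x) 0 := by
    intro h
    have h2 := (measurePreserving_add_right (volume : Measure (E n)) h).quasiMeasurePreserving.ae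
      hvx
    filter_upwards [Lp.coeFn_sub (shift h (toL2 z)) (toL2 z), Lp.coeFn_sub (shift h v) v,
      coeFn_shift h (toL2 z), coeFn_shift h v, hvx, h2] with x e1 e2 e3 e4 e5 e6
    rw [e1, e2, Pi.sub_apply, Pi.sub_apply, e3, e4, e5, e6]
    exact ⟨rfl, rfl⟩
  have hnorm : ∀ h : E n, ‖shift h v - v‖ ≤ ‖shift h (toL2 z) - toL2 z‖ := by
    intro h
    refine Lp.norm_le_norm_of_ae_le ?_
    filter_upwards [hsh h] with x hx
    rw [hx.1, hx.2, Real.norm_eq_abs, Real.norm_eq_abs]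
    refine (abs_max_sub_max_le_abs _ _ _).trans ?_
    rw [neg_sub_neg, abs_sub_comm]
  -- The map `s ↦ max (-s) 0` is nonincreasing, so the increments of `z` and of its negative part
  -- have opposite signs. This sign survives in the limit of difference quotients and replaces the
  -- chain rule for truncations.
  have hneg : ∀ h : E n, inner ℝ (shift h (toL2 z) - toL2 z) (shift h v - v) ≤ 0 := by
    intro h
    rw [inner_eq_integral]
    refine integral_nonpos_of_ae ?_
    filter_upwards [hsh h] with x hx
    rw [hx.1, hx.2, Pi.zero_apply]
    rcases le_total (toL2 z (x + h)) (toL2 z x) with hle | hle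
    · refine mul_nonpos_of_nonpos_of_nonneg (sub_nonpos.2 hle) (sub_nonneg.2 ?_)
      exact max_le_max_right _ (neg_le_neg hle)
    · refine mul_nonpos_of_nonneg_of_nonpos (sub_nonneg.2 hle) (sub_nonpos.2 ?_)
      exact max_le_max_right _ (neg_le_neg hle)
  have hex : ∀ i, ∃ g, IsWeakPartial (b i) v g := fun i =>
    exists_isWeakPartial fun t =>
      (hnorm _).trans ((isWeakPartial_dirDeriv z (b i)).norm_shift_sub_le t)
  choose g hg using hex
  obtain ⟨m, hm, hmg⟩ := exists_H1_of_isWeakPartial v g hg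
  refine ⟨m, by rwa [hm], ?_⟩
  rw [dirichletForm_eq_sum]
  refine Finset.sum_nonpos fun i _ => ?_
  rw [hmg]
  -- Both quotients converge in norm, so their inner products converge as well.
  refine le_of_tendsto ((isWeakPartial_dirDeriv z (b i)).tendsto_slope.inner (hg i).tendsto_slope)
    (Eventually.of_forall fun t => ?_)
  rw [real_inner_smul_left, real_inner_smul_right, ← mul_assoc]
  exact mul_nonpos_of_nonneg_of_nonpos (mul_self_nonneg _) (hneg _)

/-! ### Multiplication by bounded functions -/

theorem coeFn_smul_LInf (β : LInf n) (u : L2 n) :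
    (β • u : L2 n) =ᵐ[volume] fun x => β x * u x :=
  Lp.coeFn_lpSMul β u

theorem inner_smul_LInf (β : LInf n) (u v : L2 n) :
    inner ℝ (β • u : L2 n) v = ∫ x, β x * u x * v x := by
  rw [inner_eq_integral]
  refine integral_congr_ae ?_
  filter_upwards [coeFn_smul_LInf β u] with x hx
  rw [hx]

theorem integrable_LInf_mul_mul (β : LInf n) (u v : L2 n) :
    Integrable (fun x => β x * u x * v x) := by
  refine (integrable_mul_L2 (β • u : L2 n) v).congr ?_
  filter_upwards [coeFn_smul_LInf β u] with x hx
  rw [hx]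

/-- Multiplication by a bounded function on `L²(ℝⁿ)`. -/
def mulL (β : LInf n) : L2 n →L[ℝ] L2 n :=
  LinearMap.mkContinuous
    { toFun := fun u => β • u
      map_add' := fun u v => Lp.add_smul β u v
      map_smul' := fun c u => (Lp.smul_comm c β u).symm } ‖β‖ (Lp.norm_smul_le β)

theorem mulL_apply (β : LInf n) (u : L2 n) : mulL β u = β • u := rfl

theorem inner_smul_LInf_comm (β : LInf n) (u v : L2 n) :
    inner ℝ (β • u : L2 n) v = inner ℝ (β • v : L2 n) u := by
  rw [inner_smul_LInf, inner_smul_LInf]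
  exact integral_congr_ae (Eventually.of_forall fun x => by ring)

theorem le_inner_smul_LInf {β : LInf n} {c : ℝ} (hβ : ∀ᵐ x, c ≤ β x) (u : L2 n) :
    c * ‖u‖ ^ 2 ≤ inner ℝ (β • u : L2 n) u := by
  rw [← real_inner_self_eq_norm_sq, inner_smul_LInf, inner_eq_integral, ← integral_const_mul]
  refine integral_mono_ae ((integrable_mul_L2 u u).const_mul c) (integrable_LInf_mul_mul β u u) ?_
  filter_upwards [hβ] with x hx
  rw [mul_assoc]
  exact mul_le_mul_of_nonneg_right hx (mul_self_nonneg _)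

/-! ### The energy form -/

/-- The form `∫ ∇u · ∇φ + τ² ∫ β u φ`. -/
def energyForm (β : LInf n) (τ : ℝ) (u φ : H1 n) : ℝ :=
  dirichletForm u φ + τ ^ 2 * inner ℝ (β • toL2 u : L2 n) (toL2 φ)

theorem dirichletForm_comm (u φ : H1 n) : dirichletForm u φ = dirichletForm φ u :=
  real_inner_comm _ _

theorem energyForm_comm (β : LInf n) (τ : ℝ) (u φ : H1 n) :
    energyForm β τ u φ = energyForm β τ φ u := by
  unfold energyForm
  rw [dirichletForm_comm, inner_smul_LInf_comm]

/-- The energy form as a continuous bilinear form. -/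
def energyFormL (β : LInf n) (τ : ℝ) : H1 n →L[ℝ] H1 n →L[ℝ] ℝ :=
  (innerSL ℝ).bilinearComp (gradL n) (gradL n) +
    τ ^ 2 • (innerSL ℝ).bilinearComp ((mulL β).comp (toL2L n)) (toL2L n)

theorem energyFormL_apply (β : LInf n) (τ : ℝ) (u φ : H1 n) :
    energyFormL β τ u φ = energyForm β τ u φ := rfl

theorem energyForm_sub_left (β : LInf n) (τ : ℝ) (u v φ : H1 n) :
    energyForm β τ (u - v) φ = energyForm β τ u φ - energyForm β τ v φ := by
  simp only [← energyFormL_apply, map_sub, _root_.sub_apply]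

theorem energyForm_sub_right (β : LInf n) (τ : ℝ) (u v φ : H1 n) :
    energyForm β τ φ (u - v) = energyForm β τ φ u - energyForm β τ φ v := by
  simp only [← energyFormL_apply, map_sub]

theorem energyForm_smul_left (β : LInf n) (τ c : ℝ) (u φ : H1 n) :
    energyForm β τ (c • u) φ = c * energyForm β τ u φ := by
  simp only [← energyFormL_apply, map_smul, _root_.smul_apply, smul_eq_mul]

theorem le_energyForm_self {β : LInf n} {c : ℝ} (hβ : ∀ᵐ x, c ≤ β x) (τ : ℝ) (u : H1 n) :
    ‖grad u‖ ^ 2 + τ ^ 2 * (c * ‖toL2 u‖ ^ 2) ≤ energyForm β τ u u := by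
  unfold energyForm dirichletForm
  rw [real_inner_self_eq_norm_sq]
  gcongr
  exact le_inner_smul_LInf hβ _

/-- Weak supersolutions of `-Δu + τ² β u = 0` are nonnegative. -/
theorem nonneg_of_energyForm_nonneg {β : LInf n} {c : ℝ} (hc : 0 < c) (hβ : ∀ᵐ x, c ≤ β x)
    {τ : ℝ} (hτ : τ ≠ 0) {z : H1 n}
    (h : ∀ φ : H1 n, (∀ᵐ x, 0 ≤ toL2 φ x) → 0 ≤ energyForm β τ z φ) :
    ∀ᵐ x, 0 ≤ toL2 z x := by
  obtain ⟨m, hm, hd⟩ := exists_negPart z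
  -- Testing with the negative part `m` makes the Dirichlet term nonpositive and the zero-order term
  -- equal to `-τ²∫ βm²`. Their sum being nonnegative forces `m = 0`.
  have h1 := h m (by filter_upwards [hm] with x hx; rw [hx]; exact le_max_right _ _)
  have h2 : inner ℝ (β • toL2 z : L2 n) (toL2 m) = -inner ℝ (β • toL2 m : L2 n) (toL2 m) := by
    rw [inner_smul_LInf, inner_smul_LInf, ← integral_neg]
    refine integral_congr_ae ?_
    filter_upwards [hm] with x hx
    rw [hx]
    rcases le_total (toL2 z x) 0 with hle | hle
    · rw [max_eq_left (neg_nonneg.2 hle)]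
      ring
    · rw [max_eq_right (neg_nonpos.2 hle)]
      ring
  have h3 := le_inner_smul_LInf hβ (toL2 m)
  have hτ2 : 0 < τ ^ 2 := by positivity
  have h4 : ‖toL2 m‖ ^ 2 ≤ 0 := by
    unfold energyForm at h1
    rw [h2] at h1
    have : inner ℝ (β • toL2 m : L2 n) (toL2 m) ≤ 0 := by
      by_contra hcon
      push Not at hcon
      nlinarith [mul_pos hτ2 hcon]
    by_contra hcon
    push Not at hcon
    nlinarith [mul_pos hc hcon]
  have h5 : toL2 m = 0 := by
    rw [← norm_eq_zero]
    nlinarith [norm_nonneg (toL2 m)]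
  filter_upwards [hm, Lp.coeFn_zero ℝ 2 (volume : Measure (E n))] with x hx h0
  rw [h5, h0] at hx
  have := le_max_left (-toL2 z x) 0
  rw [← hx, Pi.zero_apply] at this
  linarith

/-- Lax–Milgram: the zero-order term controls the `L²` norm, so the form is coercive with constant
`min 1 (τ²c)`. -/
theorem exists_energyForm_eq {β : LInf n} {c : ℝ} (hc : 0 < c) (hβ : ∀ᵐ x, c ≤ β x)
    {τ : ℝ} (hτ : τ ≠ 0) (l : L2 n) :
    ∃ v : H1 n, ∀ φ : H1 n, energyForm β τ v φ = inner ℝ l (toL2 φ) := by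
  have hcoer : IsCoercive (energyFormL β τ) := by
    have hτ2 : 0 < τ ^ 2 := by positivity
    refine ⟨min 1 (τ ^ 2 * c), lt_min one_pos (by positivity), fun u => ?_⟩
    rw [mul_assoc, ← sq, norm_sq_H1, energyFormL_apply]
    refine le_trans ?_ (le_energyForm_self hβ τ u)
    have h1 := mul_le_mul_of_nonneg_right (min_le_left 1 (τ ^ 2 * c)) (sq_nonneg ‖grad u‖)
    have h2 := mul_le_mul_of_nonneg_right (min_le_right 1 (τ ^ 2 * c)) (sq_nonneg ‖toL2 u‖)
    linarith
  set y := (InnerProductSpace.toDual ℝ (H1 n)).symm (toH1Dual l) with hy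
  refine ⟨hcoer.continuousLinearEquivOfBilin.symm y, fun φ => ?_⟩
  rw [← energyFormL_apply, ← hcoer.continuousLinearEquivOfBilin_apply,
    ContinuousLinearEquiv.apply_symm_apply, hy, InnerProductSpace.toDual_symm_apply]
  rfl

/-- Test with `v` itself. The decay in `τ` is fast enough that `τ‖v‖` and the full `H¹` norm of `v`
still tend to zero, as the remainders require. -/
theorem norm_le_of_energyForm_eq {β : LInf n} {c : ℝ} (hc : 0 < c) (hβ : ∀ᵐ x, c ≤ β x)
    {τ : ℝ} (hτ : 0 < τ) {l : L2 n} {v : H1 n}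
    (hv : ∀ φ : H1 n, energyForm β τ v φ = inner ℝ l (toL2 φ)) :
    ‖toL2 v‖ ≤ ‖l‖ / (c * τ ^ 2) ∧ ‖grad v‖ ^ 2 ≤ ‖l‖ ^ 2 / (c * τ ^ 2) := by
  have h1 := le_energyForm_self hβ τ v
  rw [hv v] at h1
  have h2 := real_inner_le_norm l (toL2 v)
  have hk : 0 < c * τ ^ 2 := by positivity
  have h3 : ‖toL2 v‖ ≤ ‖l‖ / (c * τ ^ 2) := by
    rw [le_div_iff₀ hk]
    rcases (norm_nonneg (toL2 v)).eq_or_lt with h0 | h0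
    · rw [← h0, zero_mul]
      exact norm_nonneg _
    · refine le_of_mul_le_mul_right ?_ h0
      nlinarith [sq_nonneg ‖grad v‖]
  refine ⟨h3, ?_⟩
  calc ‖grad v‖ ^ 2 ≤ ‖l‖ * ‖toL2 v‖ := by nlinarith [sq_nonneg ‖toL2 v‖]
    _ ≤ ‖l‖ * (‖l‖ / (c * τ ^ 2)) := mul_le_mul_of_nonneg_left h3 (norm_nonneg _)
    _ = _ := by ring

end Sobolev

/-! ### The Laplace transform of a weak solution -/

section Laplace

variable {n : ℕ}

set_option maxSynthPendingDepth 3 in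
/-- The embedding of `L²(ℝⁿ)` into `H¹(ℝⁿ)'` as a continuous linear map. -/
def toH1DualL (n : ℕ) : L2 n →L[ℝ] H1Dual n :=
  ((ContinuousLinearMap.compL ℝ (H1 n) (L2 n) ℝ).flip (toL2L n)).comp (innerSL ℝ)

theorem toH1Dual_apply (g : L2 n) (φ : H1 n) : toH1Dual g φ = inner ℝ g (toL2 φ) := rfl

set_option maxSynthPendingDepth 3 in
/-- The Laplace transform over `]0, T[` of a weak solution solves a stationary equation up to a
term of size `e^{-τ T}`. -/
theorem IsWeakSolution.exists_laplace {α : LInf n} {f : L2 n} {T : ℝ} (hT : 0 < T)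
    {u : ℝ → H1 n} (hu : IsWeakSolution α f T u) :
    ∃ (R : H1Dual n) (S : L2 n), ∀ τ : ℝ, ∃ W : H1 n,
      toL2 W = finiteLaplace T τ (fun t => toL2 (u t)) ∧
      ∀ φ : H1 n, energyForm α τ W φ = inner ℝ (α • f : L2 n) (toL2 φ)
        - Real.exp (-τ * T) * (R φ + τ * inner ℝ S (toL2 φ)) := by
  obtain ⟨hu2, u', g, hu', huw, hg, hgw, heq, ⟨c₁, hc₁, h10, h1e⟩, ⟨c₂, hc₂, h20, h2e⟩⟩ := hu
  have hui : IntegrableOn u (Ioo 0 T) := hu2.integrableOn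
  have hu'i : IntegrableOn u' (Ioo 0 T) := hu'.integrableOn
  have hgi : IntegrableOn g (Ioo 0 T) := hg.integrableOn
  -- `R` is the end value of `αu'` in the dual space and `S` is `α` times the end value of `u`, both
  -- at time `T` and independent of `τ`.
  refine ⟨c₂ T, (α • c₁ T : L2 n), fun τ => ⟨finiteLaplace T τ u, ?_, fun φ => ?_⟩⟩
  · exact (finiteLaplace_comp_clm (toL2L n) hui τ).symm
  -- Integrating by parts in time once for `u` and once for `αu'` produces the factor `τ²` and the
  -- boundary terms at `0` and `T`.
  have e1 := huw.finiteLaplace_eq hT hc₁ h1e ((toL2L n).integrable_comp hui) hu'i τ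
  have e2 := hgw.finiteLaplace_eq hT hc₂ h2e
    (((toH1DualL n).comp (mulL α)).integrable_comp hu'i) hgi τ
  have e3 : finiteLaplace T τ (fun t => toH1Dual (α • u' t : L2 n))
      = toH1Dual (α • finiteLaplace T τ u' : L2 n) :=
    finiteLaplace_comp_clm ((toH1DualL n).comp (mulL α)) hu'i τ
  have e4 : finiteLaplace T τ (fun t => toL2 (u t)) = toL2 (finiteLaplace T τ u) :=
    finiteLaplace_comp_clm (toL2L n) hui τ
  have e5 : finiteLaplace T τ g φ = -dirichletForm (finiteLaplace T τ u) φ := by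
    have h1 : finiteLaplace T τ (fun t => g t φ) = finiteLaplace T τ g φ :=
      finiteLaplace_comp_clm (ContinuousLinearMap.apply ℝ ℝ φ) hgi τ
    have h2 : finiteLaplace T τ (fun t => dirichletForm (u t) φ)
        = dirichletForm (finiteLaplace T τ u) φ :=
      finiteLaplace_comp_clm
        ((innerSL ℝ).bilinearComp (gradL n) (gradL n) |>.flip φ) hui τ
    rw [← h1, ← h2]
    unfold finiteLaplace
    rw [← integral_neg]
    refine integral_congr_ae ?_
    filter_upwards [heq φ] with t ht
    rw [eq_neg_of_add_eq_zero_left ht, smul_neg]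
  have e6 := congrArg (fun L : H1Dual n => L φ) e2
  simp only [e3, e1, e4, h10, h20, _root_.add_apply, _root_.sub_apply,
    _root_.smul_apply, smul_eq_mul, toH1Dual_apply, sub_zero, e5] at e6
  rw [← mulL_apply α (_ + _), map_add, map_smul, map_smul, mulL_apply, mulL_apply, inner_add_left,
    real_inner_smul_left, real_inner_smul_left] at e6
  unfold energyForm
  linarith

/-- The remainders in the Laplace transforms vanish asymptotically. -/
theorem tendsto_remainder {β : LInf n} {c : ℝ} (hc : 0 < c) (hβ : ∀ᵐ x, c ≤ β x) {l : L2 n}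
    {v : ℝ → H1 n} (hv : ∀ τ > 0, ∀ φ : H1 n, energyForm β τ (v τ) φ = inner ℝ l (toL2 φ))
    (R : H1Dual n) (S : L2 n) :
    Tendsto (fun τ : ℝ => R (v τ) + τ * inner ℝ S (toL2 (v τ))) atTop (𝓝 0) := by
  have hinv : Tendsto (fun τ : ℝ => τ⁻¹) atTop (𝓝 0) := tendsto_inv_atTop_zero
  have h1 : Tendsto (fun τ : ℝ => ‖l‖ / c * τ⁻¹) atTop (𝓝 0) := by
    simpa using hinv.const_mul (‖l‖ / c)
  have h2 : Tendsto (fun τ => τ * ‖toL2 (v τ)‖) atTop (𝓝 0) := by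
    refine squeeze_zero' ?_ ?_ h1
    · filter_upwards [eventually_gt_atTop 0] with τ hτ
      positivity
    · filter_upwards [eventually_gt_atTop 0] with τ hτ
      calc τ * ‖toL2 (v τ)‖ ≤ τ * (‖l‖ / (c * τ ^ 2)) :=
            mul_le_mul_of_nonneg_left (norm_le_of_energyForm_eq hc hβ hτ (hv τ hτ)).1 hτ.le
        _ = ‖l‖ / c * τ⁻¹ := by field_simp
  have h3 : Tendsto (fun τ => ‖toL2 (v τ)‖ ^ 2) atTop (𝓝 0) := by
    have h4 : Tendsto (fun τ => ‖toL2 (v τ)‖) atTop (𝓝 0) := by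
      refine squeeze_zero' (Eventually.of_forall fun _ => norm_nonneg _) ?_ h2
      filter_upwards [eventually_ge_atTop 1] with τ hτ
      exact le_mul_of_one_le_left (norm_nonneg _) hτ
    simpa using h4.pow 2
  have h5 : Tendsto (fun τ => ‖grad (v τ)‖ ^ 2) atTop (𝓝 0) := by
    have h6 : Tendsto (fun τ : ℝ => ‖l‖ ^ 2 / c * τ⁻¹ ^ 2) atTop (𝓝 0) := by
      simpa using (hinv.pow 2).const_mul (‖l‖ ^ 2 / c)
    refine squeeze_zero' (Eventually.of_forall fun _ => sq_nonneg _) ?_ h6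
    filter_upwards [eventually_gt_atTop 0] with τ hτ
    refine (norm_le_of_energyForm_eq hc hβ hτ (hv τ hτ)).2.trans_eq ?_
    field_simp
  have h7 : Tendsto (fun τ => ‖v τ‖) atTop (𝓝 0) := by
    have h8 := (h3.add h5).sqrt
    simp only [← norm_sq_H1, add_zero, Real.sqrt_zero, Real.sqrt_sq (norm_nonneg _)] at h8
    exact h8
  have h9 : Tendsto (fun τ => R (v τ)) atTop (𝓝 0) := by
    refine squeeze_zero_norm (fun τ => R.le_opNorm (v τ)) ?_
    simpa using h7.const_mul ‖R‖
  have h10 : Tendsto (fun τ => τ * inner ℝ S (toL2 (v τ))) atTop (𝓝 0) := by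
    refine squeeze_zero_norm' (a := fun τ => ‖S‖ * (τ * ‖toL2 (v τ)‖)) ?_ ?_
    · filter_upwards [eventually_gt_atTop 0] with τ hτ
      rw [norm_mul, Real.norm_of_nonneg hτ.le]
      calc τ * ‖inner ℝ S (toL2 (v τ))‖ ≤ τ * (‖S‖ * ‖toL2 (v τ)‖) :=
            mul_le_mul_of_nonneg_left (norm_inner_le_norm _ _) hτ.le
        _ = _ := by ring
    · simpa using h2.const_mul ‖S‖
  simpa using h9.add h10

theorem coeFn_ballIndicator (p : E n) (η : ℝ) :
    ballIndicator p η =ᵐ[volume] (Metric.ball p η).indicator fun _ => (1 : ℝ) :=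
  indicatorConstLp_coeFn

/-- Restriction to `B` is continuous and linear, so it commutes with the Laplace transform; the
factor `χ_B` then allows the integral to be taken over the whole space. -/
theorem indicatorFunction_eq {α₀ : LInf n} {p : E n} {η T : ℝ} {u V : ℝ → H1 n}
    {Ve : ℝ → L2Ball p η} (hV : IntegrableOn V (Ioo 0 T))
    (hVe : ∀ᵐ t ∂(volume.restrict (Ioo 0 T)),
      (Ve t : E n → ℝ) =ᵐ[volume.restrict (Metric.ball p η)] (toL2 (V t) : E n → ℝ)) (τ : ℝ) :
    indicatorFunction α₀ p η T u Ve τ = inner ℝ (α₀ • ballIndicator p η : L2 n)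
      ((finiteLaplace T τ fun t => toL2 (u t)) - finiteLaplace T τ fun t => toL2 (V t)) := by
  set B := Metric.ball p η with hB
  have h1 : finiteLaplace T τ Ve
      = LpToLpRestrictCLM (E n) ℝ ℝ volume 2 B (finiteLaplace T τ fun t => toL2 (V t)) := by
    rw [← finiteLaplace_comp_clm (LpToLpRestrictCLM (E n) ℝ ℝ volume 2 B)
      (u := fun t => toL2 (V t)) ((toL2L n).integrable_comp hV)]
    refine finiteLaplace_congr ?_
    filter_upwards [hVe] with t ht
    exact Lp.ext (ht.trans (LpToLpRestrictCLM_coeFn ℝ B (toL2 (V t))).symm)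
  unfold indicatorFunction
  rw [inner_smul_LInf, h1]
  have h2 : ∫ x, α₀ x * ballIndicator p η x *
      ((finiteLaplace T τ fun t => toL2 (u t)) - finiteLaplace T τ fun t => toL2 (V t) : L2 n) x
      = ∫ x, B.indicator (fun x => α₀ x * ballIndicator p η x *
      ((finiteLaplace T τ fun t => toL2 (u t) : L2 n) x
        - (finiteLaplace T τ fun t => toL2 (V t) : L2 n) x)) x := by
    refine integral_congr_ae ?_
    filter_upwards [coeFn_ballIndicator p η, Lp.coeFn_sub
      (finiteLaplace T τ fun t => toL2 (u t)) (finiteLaplace T τ fun t => toL2 (V t))] with x h3 h4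
    rw [h4, Pi.sub_apply]
    by_cases hx : x ∈ B
    · rw [indicator_of_mem hx]
    · rw [indicator_of_notMem hx, h3, indicator_of_notMem hx, mul_zero, zero_mul]
  rw [h2, integral_indicator measurableSet_ball]
  refine integral_congr_ae ?_
  filter_upwards [LpToLpRestrictCLM_coeFn ℝ B (finiteLaplace T τ fun t => toL2 (V t))] with x hx
  rw [hx]

/-- The indicator function differs from its stationary counterpart by `o(e^{-τ T})`. -/
theorem tendsto_exp_mul_indicatorFunction_sub {α₀ α : LInf n} {c : ℝ} (hc : 0 < c)
    (hα₀ : ∀ᵐ x, c ≤ α₀ x) (hα : ∀ᵐ x, c ≤ α x) {p : E n} {η T : ℝ} (hT : 0 < T)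
    (hl : (α • ballIndicator p η : L2 n) = α₀ • ballIndicator p η) {u : ℝ → H1 n}
    {Ve : ℝ → L2Ball p η} (hu : IsWeakSolution α (ballIndicator p η) T u)
    (hVe : IsReferenceWave α₀ p η T Ve) {v w : ℝ → H1 n}
    (hv : ∀ τ > 0, ∀ φ : H1 n,
      energyForm α₀ τ (v τ) φ = inner ℝ (α₀ • ballIndicator p η : L2 n) (toL2 φ))
    (hw : ∀ τ > 0, ∀ φ : H1 n,
      energyForm α τ (w τ) φ = inner ℝ (α₀ • ballIndicator p η : L2 n) (toL2 φ)) :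
    Tendsto (fun τ : ℝ => Real.exp (τ * T) * (indicatorFunction α₀ p η T u Ve τ
      - inner ℝ (α₀ • ballIndicator p η : L2 n) (toL2 (w τ) - toL2 (v τ)))) atTop (𝓝 0) := by
  obtain ⟨V, hV, hVe⟩ := hVe
  obtain ⟨R₁, S₁, h1⟩ := hu.exists_laplace hT
  obtain ⟨R₂, S₂, h2⟩ := hV.exists_laplace hT
  have hlim := (tendsto_remainder hc hα₀ hv R₂ S₂).sub (tendsto_remainder hc hα hw R₁ S₁)
  rw [sub_zero] at hlim
  refine hlim.congr' ?_
  filter_upwards [eventually_gt_atTop 0] with τ hτ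
  rw [indicatorFunction_eq hV.1.integrableOn hVe]
  obtain ⟨W₁, hW₁, e1⟩ := h1 τ
  obtain ⟨W₂, hW₂, e2⟩ := h2 τ
  -- The source is rewritten through the exact stationary equations, and symmetry of the forms moves
  -- `w` and `v` into the role of test functions. The main terms cancel because the sources agree,
  -- leaving only the remainders evaluated at `w` and `v`.
  rw [← hW₁, ← hW₂, inner_sub_right, inner_sub_right, ← hw τ hτ W₁, ← hv τ hτ W₂,
    energyForm_comm α, energyForm_comm α₀, e1, e2, hl]
  have hexp : Real.exp (τ * T) * Real.exp (-τ * T) = 1 := by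
    rw [← Real.exp_add]
    simp
  linear_combination (R₁ (w τ) + τ * inner ℝ S₁ (toL2 (w τ)) - R₂ (v τ)
    - τ * inner ℝ S₂ (toL2 (v τ))) * hexp

/-! ### The stationary indicator -/

theorem energyForm_sub_energyForm {α₀ α : LInf n} {D : Set (E n)} (hD : MeasurableSet D)
    (hout : ∀ᵐ x ∂(volume.restrict Dᶜ), α x = α₀ x) (τ : ℝ) (a b : H1 n) :
    energyForm α τ a b - energyForm α₀ τ a b
      = τ ^ 2 * ∫ x in D, (α x - α₀ x) * toL2 a x * toL2 b x := by
  unfold energyForm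
  rw [add_sub_add_left_eq_sub, ← mul_sub, inner_smul_LInf, inner_smul_LInf,
    ← integral_sub (integrable_LInf_mul_mul _ _ _) (integrable_LInf_mul_mul _ _ _),
    ← integral_indicator hD]
  congr 1
  refine integral_congr_ae ?_
  rw [ae_restrict_iff' hD.compl] at hout
  filter_upwards [hout] with x hx
  by_cases h : x ∈ D
  · rw [indicator_of_mem h]
    ring
  · rw [indicator_of_notMem h, hx h, sub_self]

theorem integrable_sub_LInf (α₀ α : LInf n) (u v : L2 n) :
    Integrable fun x => (α x - α₀ x) * u x * v x := by
  simp only [sub_mul]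
  exact (integrable_LInf_mul_mul α u v).sub (integrable_LInf_mul_mul α₀ u v)

section Stationary

variable {α₀ α : LInf n} {D : Set (E n)} {c τ : ℝ} {l : L2 n} {v w : H1 n}

/-- Useful when the jump `α - α₀` is negative, and for the upper bound: the only wave appearing on
`D` is the reference one. -/
theorem energyForm_diff_self (hD : MeasurableSet D)
    (hout : ∀ᵐ x ∂(volume.restrict Dᶜ), α x = α₀ x)
    (hv : ∀ φ : H1 n, energyForm α₀ τ v φ = inner ℝ l (toL2 φ))
    (hw : ∀ φ : H1 n, energyForm α τ w φ = inner ℝ l (toL2 φ)) :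
    energyForm α τ (w - v) (w - v) = inner ℝ l (toL2 w - toL2 v)
      + τ ^ 2 * ∫ x in D, (α x - α₀ x) * toL2 v x * toL2 v x := by
  rw [← energyForm_sub_energyForm hD hout, energyForm_sub_left, energyForm_sub_right,
    energyForm_sub_right, hw, hw, energyForm_comm α τ v w, hw, hv, inner_sub_right]
  ring

/-- The same expansion with the roles of the two media exchanged, useful when the jump is positive.
-/
theorem energyForm_diff_self' (hD : MeasurableSet D)
    (hout : ∀ᵐ x ∂(volume.restrict Dᶜ), α x = α₀ x)
    (hv : ∀ φ : H1 n, energyForm α₀ τ v φ = inner ℝ l (toL2 φ))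
    (hw : ∀ φ : H1 n, energyForm α τ w φ = inner ℝ l (toL2 φ)) :
    energyForm α₀ τ (w - v) (w - v) = -inner ℝ l (toL2 w - toL2 v)
      - τ ^ 2 * ∫ x in D, (α x - α₀ x) * toL2 w x * toL2 w x := by
  rw [← energyForm_sub_energyForm hD hout, energyForm_sub_left, energyForm_sub_right,
    energyForm_sub_right, hv, hv, energyForm_comm α₀ τ w v, hv, hw, inner_sub_right]
  ring

/-- The scattered part `w - v` is driven by a source supported on `D`. This is what bounds its
energy by the mass of `v` there. -/
theorem energyForm_diff (hD : MeasurableSet D)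
    (hout : ∀ᵐ x ∂(volume.restrict Dᶜ), α x = α₀ x)
    (hv : ∀ φ : H1 n, energyForm α₀ τ v φ = inner ℝ l (toL2 φ))
    (hw : ∀ φ : H1 n, energyForm α τ w φ = inner ℝ l (toL2 φ)) (φ : H1 n) :
    energyForm α τ (w - v) φ
      = -(τ ^ 2 * ∫ x in D, (α x - α₀ x) * toL2 v x * toL2 φ x) := by
  rw [← energyForm_sub_energyForm hD hout, energyForm_sub_left, hw, hv]
  ring

/-- The energy of `w - v` is nonnegative and can be dropped from `energyForm_diff_self`. -/
theorem le_inner_of_le_neg (hD : MeasurableSet D)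
    (hout : ∀ᵐ x ∂(volume.restrict Dᶜ), α x = α₀ x) (hc : 0 < c) (hα : ∀ᵐ x, c ≤ α x)
    (hv : ∀ φ : H1 n, energyForm α₀ τ v φ = inner ℝ l (toL2 φ))
    (hw : ∀ φ : H1 n, energyForm α τ w φ = inner ℝ l (toL2 φ)) {C : ℝ}
    (hin : ∀ᵐ x ∂(volume.restrict D), C ≤ -(α x - α₀ x)) :
    C * (τ ^ 2 * ∫ x in D, toL2 v x * toL2 v x) ≤ inner ℝ l (toL2 w - toL2 v) := by
  have h1 := energyForm_diff_self hD hout hv hw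
  have h2 := le_energyForm_self hα τ (w - v)
  have h3 : C * (∫ x in D, toL2 v x * toL2 v x)
      ≤ -∫ x in D, (α x - α₀ x) * toL2 v x * toL2 v x := by
    rw [← integral_const_mul, ← integral_neg]
    refine integral_mono_ae ((integrable_mul_L2 _ _).integrableOn.const_mul C)
      (integrable_sub_LInf α₀ α _ _).integrableOn.neg ?_
    filter_upwards [hin] with x hx
    nlinarith [mul_self_nonneg (toL2 v x)]
  have h4 : 0 ≤ energyForm α τ (w - v) (w - v) := h2.trans' (by positivity)
  nlinarith [mul_le_mul_of_nonneg_left h3 (sq_nonneg τ)]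

/-- Here dropping the energy would leave the mass of the unknown `w`. Keeping its zero-order part,
one uses that `c(w - v)² + Cw²`, minimised over `w`, equals `cC/(c + C) · v²`. -/
theorem inner_le_of_le (hD : MeasurableSet D)
    (hout : ∀ᵐ x ∂(volume.restrict Dᶜ), α x = α₀ x) (hc : 0 < c) (hα₀ : ∀ᵐ x, c ≤ α₀ x)
    (hv : ∀ φ : H1 n, energyForm α₀ τ v φ = inner ℝ l (toL2 φ))
    (hw : ∀ φ : H1 n, energyForm α τ w φ = inner ℝ l (toL2 φ)) {C : ℝ} (hC : 0 < C)
    (hin : ∀ᵐ x ∂(volume.restrict D), C ≤ α x - α₀ x) :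
    c * C / (c + C) * (τ ^ 2 * ∫ x in D, toL2 v x * toL2 v x)
      ≤ -inner ℝ l (toL2 w - toL2 v) := by
  have h1 := energyForm_diff_self' hD hout hv hw
  have h2 := le_energyForm_self hα₀ τ (w - v)
  have h3 : ∫ x in D, toL2 (w - v) x * toL2 (w - v) x ≤ ‖toL2 (w - v)‖ ^ 2 := by
    rw [← real_inner_self_eq_norm_sq, inner_eq_integral]
    exact setIntegral_le_integral (integrable_mul_L2 _ _)
      (Eventually.of_forall fun x => mul_self_nonneg _)
  have h4 : c * C / (c + C) * (∫ x in D, toL2 v x * toL2 v x)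
      ≤ c * (∫ x in D, toL2 (w - v) x * toL2 (w - v) x)
        + ∫ x in D, (α x - α₀ x) * toL2 w x * toL2 w x := by
    rw [← integral_const_mul, ← integral_const_mul,
      ← integral_add ((integrable_mul_L2 _ _).integrableOn.const_mul c)
        (integrable_sub_LInf α₀ α _ _).integrableOn]
    refine integral_mono_ae ((integrable_mul_L2 _ _).integrableOn.const_mul _)
      (((integrable_mul_L2 _ _).integrableOn.const_mul c).add
        (integrable_sub_LInf α₀ α _ _).integrableOn) ?_
    have hsub : ∀ᵐ x ∂(volume.restrict D), toL2 (w - v) x = toL2 w x - toL2 v x := by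
      refine ae_restrict_of_ae ?_
      rw [toL2_sub]
      exact Lp.coeFn_sub _ _
    filter_upwards [hin, hsub] with x hx hs
    rw [hs, div_mul_eq_mul_div, div_le_iff₀ (by positivity)]
    -- The identity `(c + C)(c(w - v)² + Cw²) - cCv² = (c(w - v) + Cw)²` is behind the first hint;
    -- the others account for the jump exceeding `C`.
    nlinarith [sq_nonneg (c * (toL2 w x - toL2 v x) + C * toL2 w x),
      mul_nonneg (sub_nonneg.2 hx) (mul_self_nonneg (toL2 w x)),
      mul_nonneg (mul_nonneg (sub_nonneg.2 hx) (mul_self_nonneg (toL2 w x))) hc.le,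
      mul_nonneg (mul_nonneg (sub_nonneg.2 hx) (mul_self_nonneg (toL2 w x))) hC.le]
  have h5 : τ ^ 2 * (c * ∫ x in D, toL2 (w - v) x * toL2 (w - v) x)
      ≤ energyForm α₀ τ (w - v) (w - v) := by
    refine le_trans ?_ h2
    have := mul_le_mul_of_nonneg_left (mul_le_mul_of_nonneg_left h3 hc.le) (sq_nonneg τ)
    nlinarith [sq_nonneg ‖grad (w - v)‖]
  nlinarith [mul_le_mul_of_nonneg_left h4 (sq_nonneg τ)]

/-- Testing the equation of `w - v` with itself bounds its energy by `(K²/c)τ²∫_D v²`. The term `K`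
comes from the jump integral in `energyForm_diff_self`. -/
theorem abs_inner_le (hD : MeasurableSet D)
    (hout : ∀ᵐ x ∂(volume.restrict Dᶜ), α x = α₀ x) (hc : 0 < c) (hα : ∀ᵐ x, c ≤ α x)
    (hv : ∀ φ : H1 n, energyForm α₀ τ v φ = inner ℝ l (toL2 φ))
    (hw : ∀ φ : H1 n, energyForm α τ w φ = inner ℝ l (toL2 φ)) {K : ℝ}
    (hin : ∀ᵐ x ∂(volume.restrict D), |α x - α₀ x| ≤ K) :
    |inner ℝ l (toL2 w - toL2 v)|
      ≤ (K ^ 2 / c + K) * (τ ^ 2 * ∫ x in D, toL2 v x * toL2 v x) := by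
  have h1 := energyForm_diff_self hD hout hv hw
  have h2 := le_energyForm_self hα τ (w - v)
  have h3 := energyForm_diff hD hout hv hw (w - v)
  have h4 : ∫ x in D, toL2 (w - v) x * toL2 (w - v) x ≤ ‖toL2 (w - v)‖ ^ 2 := by
    rw [← real_inner_self_eq_norm_sq, inner_eq_integral]
    exact setIntegral_le_integral (integrable_mul_L2 _ _)
      (Eventually.of_forall fun x => mul_self_nonneg _)
  -- Young's inequality, weighted so that the `w - v` term is absorbed by half of the coercive term
  -- `cτ²‖w - v‖²`.
  have h5 : -(∫ x in D, (α x - α₀ x) * toL2 v x * toL2 (w - v) x)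
      ≤ K ^ 2 / (2 * c) * (∫ x in D, toL2 v x * toL2 v x)
        + c / 2 * ∫ x in D, toL2 (w - v) x * toL2 (w - v) x := by
    rw [← integral_const_mul, ← integral_const_mul,
      ← integral_add ((integrable_mul_L2 _ _).integrableOn.const_mul _)
        ((integrable_mul_L2 _ _).integrableOn.const_mul _), ← integral_neg]
    refine integral_mono_ae (integrable_sub_LInf α₀ α _ _).integrableOn.neg
      (((integrable_mul_L2 _ _).integrableOn.const_mul _).add
        ((integrable_mul_L2 _ _).integrableOn.const_mul _)) ?_
    filter_upwards [hin] with x hx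
    set k := α x - α₀ x
    set a := toL2 v x
    set b := toL2 (w - v) x
    have hk : k ^ 2 ≤ K ^ 2 := sq_le_sq' (by linarith [(abs_le.1 hx).1]) (abs_le.1 hx).2
    have e : K ^ 2 / (2 * c) * (a * a) + c / 2 * (b * b) - -(k * a * b)
        = ((k * a + c * b) ^ 2 + (K ^ 2 - k ^ 2) * a ^ 2) / (2 * c) := by
      field_simp
      ring
    have : 0 ≤ ((k * a + c * b) ^ 2 + (K ^ 2 - k ^ 2) * a ^ 2) / (2 * c) := by
      have := sub_nonneg.2 hk
      positivity
    linarith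
  have h6 : |∫ x in D, (α x - α₀ x) * toL2 v x * toL2 v x|
      ≤ K * ∫ x in D, toL2 v x * toL2 v x := by
    rw [← integral_const_mul, ← Real.norm_eq_abs]
    refine norm_integral_le_of_norm_le ((integrable_mul_L2 _ _).integrableOn.const_mul _) ?_
    filter_upwards [hin] with x hx
    rw [mul_assoc, norm_mul, Real.norm_eq_abs, Real.norm_of_nonneg (mul_self_nonneg _)]
    exact mul_le_mul_of_nonneg_right hx (mul_self_nonneg _)
  set N := ∫ x in D, toL2 v x * toL2 v x
  set Y := ‖toL2 (w - v)‖ ^ 2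
  set Q := energyForm α τ (w - v) (w - v)
  have hY : 0 ≤ τ ^ 2 * (c * Y) := by positivity
  have hg := sq_nonneg ‖grad (w - v)‖
  have h7 : Q ≤ τ ^ 2 * (K ^ 2 / (2 * c) * N) + τ ^ 2 * (c * Y) / 2 := by
    have := mul_le_mul_of_nonneg_left h5 (sq_nonneg τ)
    have := mul_le_mul_of_nonneg_left (mul_le_mul_of_nonneg_left h4 (half_pos hc).le) (sq_nonneg τ)
    linarith
  have h8 : Q ≤ K ^ 2 / c * (τ ^ 2 * N) := by
    have e : K ^ 2 / c * (τ ^ 2 * N) = 2 * (τ ^ 2 * (K ^ 2 / (2 * c) * N)) := by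
      field_simp
    linarith
  have h9 := abs_le.1 h6
  have h10 := mul_le_mul_of_nonneg_left h9.1 (sq_nonneg τ)
  have h11 := mul_le_mul_of_nonneg_left h9.2 (sq_nonneg τ)
  rw [abs_le]
  constructor <;> linarith

end Stationary

end Laplace

/-! ### Barrier functions -/

section Barrier

variable {n : ℕ}

/-- One term of the exponential series, of degree `n + 1`, bounds the function by a multiple of the
integrable `(1 + ‖x‖)^{-(n+1)}`. -/
theorem integrable_exp_neg_mul_norm {c : ℝ} (hc : 0 < c) :
    Integrable (fun x : E n => Real.exp (-c * ‖x‖)) := by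
  have h1 : Integrable (fun x : E n => (1 + ‖x‖) ^ (-((n : ℝ) + 1))) :=
    integrable_one_add_norm (by simp)
  refine (h1.const_mul ((n + 1).factorial * Real.exp c / c ^ (n + 1))).mono'
    (by fun_prop) (Eventually.of_forall fun x => ?_)
  have h2 : 0 < 1 + ‖x‖ := by positivity
  have h3 := Real.pow_div_factorial_le_exp (c * (1 + ‖x‖)) (by positivity) (n + 1)
  have h4 : (1 + ‖x‖) ^ (-((n : ℝ) + 1)) = ((1 + ‖x‖) ^ (n + 1))⁻¹ := by
    rw [Real.rpow_neg h2.le, ← Nat.cast_succ, Real.rpow_natCast]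
  have h5 : Real.exp (c * (1 + ‖x‖)) = Real.exp c * (Real.exp (-c * ‖x‖))⁻¹ := by
    rw [← Real.exp_neg, ← Real.exp_add]
    ring_nf
  rw [h4, Real.norm_of_nonneg (Real.exp_pos _).le, ← div_eq_mul_inv, div_div, le_div_iff₀ (by positivity)]
  rw [h5, div_le_iff₀ (by positivity), mul_pow, ← div_eq_mul_inv, div_mul_eq_mul_div,
    le_div_iff₀ (Real.exp_pos _)] at h3
  linarith

/-- The regularised distance to the point `y`. -/
def regDist (y : E n) (δ : ℝ) (x : E n) : ℝ := √(‖x - y‖ ^ 2 + δ ^ 2)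

theorem regDist_sq (y : E n) (δ : ℝ) (x : E n) : regDist y δ x ^ 2 = ‖x - y‖ ^ 2 + δ ^ 2 :=
  Real.sq_sqrt (by positivity)

theorem regDist_pos (y : E n) {δ : ℝ} (hδ : 0 < δ) (x : E n) : 0 < regDist y δ x :=
  Real.sqrt_pos.2 (by positivity)

theorem le_regDist (y : E n) (δ : ℝ) (x : E n) : δ ≤ regDist y δ x :=
  Real.le_sqrt_of_sq_le (by linarith [sq_nonneg ‖x - y‖])

theorem norm_le_regDist (y : E n) (δ : ℝ) (x : E n) : ‖x - y‖ ≤ regDist y δ x :=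
  Real.le_sqrt_of_sq_le (by linarith [sq_nonneg δ])

theorem regDist_le (y : E n) {δ : ℝ} (hδ : 0 < δ) (x : E n) : regDist y δ x ≤ ‖x - y‖ + δ :=
  Real.sqrt_le_iff.2 ⟨by positivity, by nlinarith [norm_nonneg (x - y)]⟩

theorem contDiff_regDist (y : E n) {δ : ℝ} (hδ : 0 < δ) : ContDiff ℝ ∞ (regDist y δ) :=
  ContDiff.sqrt (((contDiff_id.sub contDiff_const).norm_sq ℝ).add contDiff_const) fun x => by
    positivity

theorem fderiv_regDist (y : E n) {δ : ℝ} (hδ : 0 < δ) (x e : E n) :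
    fderiv ℝ (regDist y δ) x e = inner ℝ (x - y) e / regDist y δ x := by
  have h1 := (((hasFDerivAt_id (𝕜 := ℝ) x).sub_const y).norm_sq.add_const (δ ^ 2)).sqrt
    (by positivity)
  have h2 : HasFDerivAt (regDist y δ) _ x := h1
  rw [h2.fderiv]
  simp only [regDist, id, _root_.smul_apply, ContinuousLinearMap.comp_apply,
    ContinuousLinearMap.id_apply, innerSL_apply_apply, smul_eq_mul, nsmul_eq_mul]
  push_cast
  field_simp

/-- The barrier function `exp (-k ρ)`, where `ρ` is the regularised distance to `y`. -/
def barrier (y : E n) (δ k : ℝ) (x : E n) : ℝ := Real.exp (-k * regDist y δ x)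

theorem contDiff_barrier (y : E n) {δ : ℝ} (hδ : 0 < δ) (k : ℝ) :
    ContDiff ℝ ∞ (barrier y δ k) :=
  (contDiff_const.mul (contDiff_regDist y hδ)).exp

theorem barrier_pos (y : E n) (δ k : ℝ) (x : E n) : 0 < barrier y δ k x := Real.exp_pos _

theorem memLp_barrier (y : E n) {δ k : ℝ} (hδ : 0 < δ) (hk : 0 < k) :
    MemLp (barrier y δ k) 2 := by
  have hc := (contDiff_barrier y hδ k).continuous
  rw [memLp_two_iff_integrable_sq hc.aestronglyMeasurable]
  refine ((integrable_exp_neg_mul_norm (n := n) (c := 2 * k) (by positivity)).comp_sub_right y).mono'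
    (hc.pow 2).aestronglyMeasurable (Eventually.of_forall fun x => ?_)
  rw [Real.norm_of_nonneg (sq_nonneg _), barrier, ← Real.exp_nat_mul]
  refine Real.exp_le_exp.2 ?_
  push_cast
  nlinarith [mul_le_mul_of_nonneg_left (norm_le_regDist y δ x) hk.le]

theorem fderiv_barrier (y : E n) {δ : ℝ} (hδ : 0 < δ) (k : ℝ) (x e : E n) :
    fderiv ℝ (barrier y δ k) x e
      = barrier y δ k x * (-k * (inner ℝ (x - y) e / regDist y δ x)) := by
  have h1 := ((((contDiff_regDist y hδ).differentiable (by simp) x).hasFDerivAt).const_mul (-k)).exp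
  have h2 : HasFDerivAt (barrier y δ k) _ x := h1
  rw [h2.fderiv]
  simp only [_root_.smul_apply, smul_eq_mul, fderiv_regDist y hδ]
  rfl

/-- Summed over an orthonormal basis, these second derivatives give the Laplacian of the barrier. -/
theorem fderiv_fderiv_barrier (y : E n) {δ : ℝ} (hδ : 0 < δ) (k : ℝ) (x e : E n) :
    fderiv ℝ (fun x => fderiv ℝ (barrier y δ k) x e) x e
      = barrier y δ k x * (k ^ 2 * (inner ℝ (x - y) e ^ 2 / regDist y δ x ^ 2)
        - k * (‖e‖ ^ 2 / regDist y δ x - inner ℝ (x - y) e ^ 2 / regDist y δ x ^ 3)) := by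
  simp only [fderiv_barrier y hδ]
  have hρ := (regDist_pos y hδ x).ne'
  have h1 := ((contDiff_barrier y hδ k).differentiable (by simp) x).hasFDerivAt
  have h2 := ((contDiff_regDist y hδ).differentiable (by simp) x).hasFDerivAt
  have h3 : HasFDerivAt (fun x => inner ℝ (x - y) e) (innerSL ℝ e) x := by
    have := ((innerSL ℝ e).hasFDerivAt (x := x)).sub_const (inner ℝ y e)
    refine this.congr_of_eventuallyEq (Eventually.of_forall fun z => ?_)
    simp only [innerSL_apply_apply]
    rw [inner_sub_left, real_inner_comm e z]
  have h4 := h1.mul ((h3.mul ((hasDerivAt_inv hρ).comp_hasFDerivAt x h2)).const_mul (-k))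
  have h5 : HasFDerivAt (fun x => barrier y δ k x * (-k * (inner ℝ (x - y) e / regDist y δ x))) _ x :=
    h4
  rw [h5.fderiv]
  simp only [Function.comp_apply, Pi.mul_apply, _root_.add_apply, _root_.smul_apply, smul_eq_mul,
    fderiv_regDist y hδ, fderiv_barrier y hδ, innerSL_apply_apply, real_inner_self_eq_norm_sq]
  field_simp
  ring

/-- A smooth function which is square integrable together with its derivative has a weak
derivative. -/
theorem isWeakPartial_of_contDiff {ψ : E n → ℝ} (hψ : ContDiff ℝ ∞ ψ) {e : E n}
    (h1 : MemLp ψ 2) (h2 : MemLp (fun x => fderiv ℝ ψ x e) 2) :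
    IsWeakPartial e (h1.toLp _) (h2.toLp _) := by
  intro φ hφ hc
  have hφm := memLp_test hφ.continuous hc
  have hφ' := memLp_test_fderiv hφ hc e
  have h := integral_mul_fderiv_eq_neg_fderiv_mul_of_integrable (μ := (volume : Measure (E n)))
    (f := ψ) (g := φ) (v := e) (h2.integrable_mul hφm) (h1.integrable_mul hφ')
    (h1.integrable_mul hφm) (fun x _ => hψ.differentiable (by simp) x)
    (fun x _ => hφ.differentiable (by simp) x)
  calc ∫ x, h1.toLp _ x * fderiv ℝ φ x e = ∫ x, ψ x * fderiv ℝ φ x e := by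
        refine integral_congr_ae ?_
        filter_upwards [h1.coeFn_toLp] with x hx
        rw [hx]
    _ = -∫ x, fderiv ℝ ψ x e * φ x := h
    _ = _ := by
        congr 1
        refine integral_congr_ae ?_
        filter_upwards [h2.coeFn_toLp] with x hx
        rw [hx, mul_comm]

theorem abs_inner_div_regDist_le (y : E n) {δ : ℝ} (hδ : 0 < δ) (x e : E n) :
    |inner ℝ (x - y) e / regDist y δ x| ≤ ‖e‖ := by
  have hρ := regDist_pos y hδ x
  rw [abs_div, abs_of_pos hρ, div_le_iff₀ hρ]
  refine (abs_real_inner_le_norm _ _).trans ?_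
  rw [mul_comm]
  exact mul_le_mul_of_nonneg_left (norm_le_regDist y δ x) (norm_nonneg _)

theorem memLp_fderiv_barrier (y : E n) {δ k : ℝ} (hδ : 0 < δ) (hk : 0 < k) (e : E n) :
    MemLp (fun x => fderiv ℝ (barrier y δ k) x e) 2 := by
  have hc : Continuous fun x => fderiv ℝ (barrier y δ k) x e :=
    ((contDiff_barrier y hδ k).continuous_fderiv (by simp)).clm_apply continuous_const
  refine (memLp_barrier y hδ hk).of_le_mul (c := k * ‖e‖) hc.aestronglyMeasurable
    (Eventually.of_forall fun x => ?_)
  rw [fderiv_barrier y hδ, norm_mul, norm_mul, norm_neg, Real.norm_of_nonneg hk.le, mul_comm]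
  refine mul_le_mul_of_nonneg_right ?_ (norm_nonneg _)
  exact mul_le_mul_of_nonneg_left (abs_inner_div_regDist_le y hδ x e) hk.le

theorem contDiff_fderiv_barrier (y : E n) {δ : ℝ} (hδ : 0 < δ) (k : ℝ) (e : E n) :
    ContDiff ℝ ∞ (fun x => fderiv ℝ (barrier y δ k) x e) :=
  ((contDiff_barrier y hδ k).fderiv_right (m := ∞) (by simp)).clm_apply contDiff_const

/-- The second derivatives are bounded multiples of the barrier, because `‖x - y‖ ≤ ρ` and `ρ ≥ δ`;
the regularisation removes the singularity at `y`. -/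
theorem memLp_fderiv_fderiv_barrier (y : E n) {δ k : ℝ} (hδ : 0 < δ) (hk : 0 < k) (e : E n) :
    MemLp (fun x => fderiv ℝ (fun x => fderiv ℝ (barrier y δ k) x e) x e) 2 := by
  have hc : Continuous fun x => fderiv ℝ (fun x => fderiv ℝ (barrier y δ k) x e) x e :=
    ((contDiff_fderiv_barrier y hδ k e).continuous_fderiv (by simp)).clm_apply continuous_const
  refine (memLp_barrier y hδ hk).of_le_mul (c := k ^ 2 * ‖e‖ ^ 2 + 2 * k * (‖e‖ ^ 2 / δ))
    hc.aestronglyMeasurable (Eventually.of_forall fun x => ?_)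
  have hρ := regDist_pos y hδ x
  set a := inner ℝ (x - y) e / regDist y δ x with ha
  have hd : ‖e‖ ^ 2 / regDist y δ x ≤ ‖e‖ ^ 2 / δ :=
    div_le_div_of_nonneg_left (sq_nonneg _) hδ (le_regDist y δ x)
  have ha2 : a ^ 2 ≤ ‖e‖ ^ 2 := sq_le_sq' (by linarith [(abs_le.1
    (abs_inner_div_regDist_le y hδ x e)).1]) (abs_le.1 (abs_inner_div_regDist_le y hδ x e)).2
  have e1 : k ^ 2 * (inner ℝ (x - y) e ^ 2 / regDist y δ x ^ 2)
        - k * (‖e‖ ^ 2 / regDist y δ x - inner ℝ (x - y) e ^ 2 / regDist y δ x ^ 3)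
      = k ^ 2 * a ^ 2 - k * (‖e‖ ^ 2 / regDist y δ x) + k * (a ^ 2 / regDist y δ x) := by
    rw [ha]
    field_simp
    ring
  have h1 : a ^ 2 / regDist y δ x ≤ ‖e‖ ^ 2 / δ :=
    (div_le_div_of_nonneg_right ha2 hρ.le).trans hd
  have h2 : 0 ≤ a ^ 2 / regDist y δ x := by positivity
  have h3 : 0 ≤ ‖e‖ ^ 2 / regDist y δ x := by positivity
  rw [fderiv_fderiv_barrier y hδ, e1, norm_mul, mul_comm]
  refine mul_le_mul_of_nonneg_right ?_ (norm_nonneg _)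
  rw [Real.norm_eq_abs, abs_le]
  have h4 := mul_le_mul_of_nonneg_left ha2 (sq_nonneg k)
  have h5 := mul_le_mul_of_nonneg_left h1 hk.le
  have h6 := mul_le_mul_of_nonneg_left hd hk.le
  have h7 := mul_nonneg hk.le h2
  have h8 := mul_nonneg hk.le h3
  have h9 : 0 ≤ k ^ 2 * a ^ 2 := by positivity
  constructor <;> linarith

/-- The energy form on a barrier function, computed by two integrations by parts. -/
theorem exists_H1_barrier (y : E n) {δ k : ℝ} (hδ : 0 < δ) (hk : 0 < k) :
    ∃ s : H1 n, (∀ᵐ x, toL2 s x = barrier y δ k x) ∧ ∀ (β : LInf n) (τ : ℝ) (φ : H1 n),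
      Integrable (fun x => barrier y δ k x * (τ ^ 2 * β x
        - k ^ 2 * (‖x - y‖ ^ 2 / regDist y δ x ^ 2)
        + k * (n / regDist y δ x - ‖x - y‖ ^ 2 / regDist y δ x ^ 3)) * toL2 φ x) ∧
      energyForm β τ s φ = ∫ x, barrier y δ k x * (τ ^ 2 * β x
        - k ^ 2 * (‖x - y‖ ^ 2 / regDist y δ x ^ 2)
        + k * (n / regDist y δ x - ‖x - y‖ ^ 2 / regDist y δ x ^ 3)) * toL2 φ x := by
  set b := EuclideanSpace.basisFun (Fin n) ℝ with hb
  have hm := memLp_barrier y hδ hk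
  have hm' := fun i => memLp_fderiv_barrier y hδ hk (b i)
  have hm'' := fun i => memLp_fderiv_fderiv_barrier y hδ hk (b i)
  obtain ⟨s, hs, hsd⟩ := exists_H1_of_isWeakPartial (hm.toLp _) (fun i => (hm' i).toLp _)
    fun i => isWeakPartial_of_contDiff (contDiff_barrier y hδ k) hm (hm' i)
  have hsx : ∀ᵐ x, toL2 s x = barrier y δ k x := by
    rw [hs]
    exact hm.coeFn_toLp
  refine ⟨s, hsx, fun β τ φ => ?_⟩
  have h1 : energyForm β τ s φ
      = ∑ i, -inner ℝ (toL2 φ) ((hm'' i).toLp _)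
        + τ ^ 2 * inner ℝ (β • toL2 s : L2 n) (toL2 φ) := by
    unfold energyForm
    rw [dirichletForm_eq_sum]
    congr 1
    refine Finset.sum_congr rfl fun i _ => ?_
    rw [hsd, real_inner_comm]
    exact (isWeakPartial_dirDeriv φ (b i)).inner_eq_neg
      (isWeakPartial_of_contDiff (contDiff_fderiv_barrier y hδ k (b i)) (hm' i) (hm'' i))
  have hi1 : ∀ i ∈ Finset.univ, Integrable fun x => -(toL2 φ x * (hm'' i).toLp _ x) :=
    fun i _ => (integrable_mul_L2 _ _).neg
  have hi2 : Integrable fun x => τ ^ 2 * (β x * toL2 s x * toL2 φ x) :=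
    (integrable_LInf_mul_mul β _ _).const_mul _
  have hae : ∀ᵐ x, (∑ i, -(toL2 φ x * (hm'' i).toLp _ x)) + τ ^ 2 * (β x * toL2 s x * toL2 φ x)
      = barrier y δ k x * (τ ^ 2 * β x
        - k ^ 2 * (‖x - y‖ ^ 2 / regDist y δ x ^ 2)
        + k * (n / regDist y δ x - ‖x - y‖ ^ 2 / regDist y δ x ^ 3)) * toL2 φ x := by
    have h2 : ∀ᵐ x, ∀ i, (hm'' i).toLp _ x
        = fderiv ℝ (fun x => fderiv ℝ (barrier y δ k) x (b i)) x (b i) :=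
      ae_all_iff.2 fun i => (hm'' i).coeFn_toLp
    filter_upwards [h2, hsx] with x hx hx'
    have e1 : ∑ i, inner ℝ (x - y) (b i) ^ 2 = ‖x - y‖ ^ 2 := by
      rw [← b.sum_sq_norm_inner_left (x - y)]
      exact Finset.sum_congr rfl fun i _ => by rw [Real.norm_eq_abs, sq_abs]
    have e2 : ∑ i, -(toL2 φ x * (hm'' i).toLp _ x)
        = -toL2 φ x * barrier y δ k x * ∑ i, (k ^ 2 * (inner ℝ (x - y) (b i) ^ 2 / regDist y δ x ^ 2)
        - k * (1 / regDist y δ x - inner ℝ (x - y) (b i) ^ 2 / regDist y δ x ^ 3)) := by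
      rw [Finset.mul_sum]
      refine Finset.sum_congr rfl fun i _ => ?_
      rw [hx, fderiv_fderiv_barrier y hδ, b.norm_eq_one]
      ring
    rw [e2, hx', Finset.sum_sub_distrib, ← Finset.mul_sum, ← Finset.mul_sum,
      Finset.sum_sub_distrib]
    simp only [Finset.sum_const, Finset.card_univ, Fintype.card_fin, nsmul_eq_mul,
      ← Finset.sum_div, e1]
    ring
  refine ⟨((integrable_finsetSum _ hi1).add hi2).congr hae, ?_⟩
  rw [h1, inner_smul_LInf]
  simp only [inner_eq_integral, ← integral_neg]
  rw [← integral_finsetSum _ hi1, ← integral_const_mul, ← integral_add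
    (integrable_finsetSum _ hi1) hi2]
  exact integral_congr_ae hae

end Barrier

/-! ### Exponential bounds for the stationary reference wave -/

section Bounds

variable {n : ℕ}

/-- `v` solves `-Δv + τ² α₀ v = α₀ χ_B` for the ball `B` with centre `p` and radius `η`. -/
def IsStationaryWave (α₀ : LInf n) (p : E n) (η τ : ℝ) (v : H1 n) : Prop :=
  ∀ φ : H1 n, energyForm α₀ τ v φ = inner ℝ (α₀ • ballIndicator p η : L2 n) (toL2 φ)

variable {α₀ : LInf n} {p : E n} {η m₀ M₀ : ℝ}

theorem IsStationaryWave.nonneg (hm₀ : 0 < m₀)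
    (hα₀ : ∀ᵐ x, m₀ ^ 2 ≤ α₀ x ∧ α₀ x ≤ M₀ ^ 2) {τ : ℝ} (hτ : 0 < τ) {v : H1 n}
    (hv : IsStationaryWave α₀ p η τ v) : ∀ᵐ x, 0 ≤ toL2 v x := by
  refine nonneg_of_energyForm_nonneg (c := m₀ ^ 2) (by positivity) (hα₀.mono fun x hx => hx.1)
    hτ.ne' fun φ hφ => ?_
  rw [hv, inner_smul_LInf]
  refine integral_nonneg_of_ae ?_
  filter_upwards [hα₀, hφ, coeFn_ballIndicator p η] with x h1 h2 h3
  rw [h3]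
  exact mul_nonneg (mul_nonneg ((sq_nonneg _).trans h1.1)
    (indicator_nonneg (fun _ _ => zero_le_one) _)) h2

/-- A pointwise upper bound by a supersolution. -/
theorem IsStationaryWave.le_barrier (hn : 1 ≤ n) (hm₀ : 0 < m₀)
    (hα₀ : ∀ᵐ x, m₀ ^ 2 ≤ α₀ x ∧ α₀ x ≤ M₀ ^ 2) (hη : 0 < η) {δ : ℝ} (hδ : 0 < δ) {τ : ℝ}
    (hτ : 0 < τ) {v : H1 n} (hv : IsStationaryWave α₀ p η τ v) :
    ∀ᵐ x, toL2 v x ≤ (η ^ 2 + δ ^ 2) / (δ ^ 2 * τ ^ 2)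
      * Real.exp (-(τ * m₀) * (‖x - p‖ - η - δ)) := by
  obtain ⟨s, hs, hsf⟩ := exists_H1_barrier p hδ (mul_pos hτ hm₀)
  -- On `B` one has `ρ ≤ η + δ` and `ρ² ≤ η² + δ²`; the constant makes `A exp(-τm₀ρ) τ²δ²/ρ² ≥ 1`
  -- there, so that the barrier dominates the source.
  set A : ℝ := (η ^ 2 + δ ^ 2) / (δ ^ 2 * τ ^ 2) * Real.exp (τ * m₀ * (η + δ)) with hA
  have hA0 : 0 < A := by positivity
  have hnn : ∀ᵐ x, 0 ≤ toL2 (A • s - v) x := by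
    refine nonneg_of_energyForm_nonneg (c := m₀ ^ 2) (by positivity)
      (hα₀.mono fun x hx => hx.1) hτ.ne' fun φ hφ => ?_
    obtain ⟨hi, he⟩ := hsf α₀ τ φ
    rw [energyForm_sub_left, energyForm_smul_left, hv, he, inner_smul_LInf, sub_nonneg,
      ← integral_const_mul]
    refine integral_mono_ae (integrable_LInf_mul_mul _ _ _) (hi.const_mul A) ?_
    filter_upwards [hα₀, hφ, coeFn_ballIndicator p η] with x h1 h2 h3
    rw [h3, ← mul_assoc]
    refine mul_le_mul_of_nonneg_right ?_ h2
    set ρ := regDist p δ x with hρ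
    have hρ0 : 0 < ρ := regDist_pos p hδ x
    have hρ2 : ρ ^ 2 = ‖x - p‖ ^ 2 + δ ^ 2 := regDist_sq p δ x
    -- This term of first order in `τ` is nonnegative because `n ≥ 1`, so it helps the
    -- supersolution.
    have e1 : (n : ℝ) / ρ - ‖x - p‖ ^ 2 / ρ ^ 3 = ((n - 1) * ρ ^ 2 + δ ^ 2) / ρ ^ 3 := by
      field_simp
      rw [hρ2]
      ring
    have hn' : (1 : ℝ) ≤ n := by exact_mod_cast hn
    have h4 : 0 ≤ (n : ℝ) / ρ - ‖x - p‖ ^ 2 / ρ ^ 3 := by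
      rw [e1]
      have := sub_nonneg.2 hn'
      positivity
    have e2 : ‖x - p‖ ^ 2 / ρ ^ 2 = 1 - δ ^ 2 / ρ ^ 2 := by
      field_simp
      rw [hρ2]
      ring
    have h5 : 0 ≤ ‖x - p‖ ^ 2 / ρ ^ 2 := by positivity
    -- Since `‖x - p‖²/ρ² = 1 - δ²/ρ²`, the bound `m₀² ≤ α₀` leaves the surplus `α₀τ²δ²/ρ²`, which
    -- is proportional to `α₀` just like the source.
    have h6 : α₀ x * (τ ^ 2 * (δ ^ 2 / ρ ^ 2)) ≤ τ ^ 2 * α₀ x - (τ * m₀) ^ 2 * (‖x - p‖ ^ 2 / ρ ^ 2)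
        + τ * m₀ * (n / ρ - ‖x - p‖ ^ 2 / ρ ^ 3) := by
      have h7 := mul_le_mul_of_nonneg_left (mul_le_mul_of_nonneg_right h1.1 h5) (sq_nonneg τ)
      have h8 := mul_nonneg (mul_pos hτ hm₀).le h4
      rw [show δ ^ 2 / ρ ^ 2 = 1 - ‖x - p‖ ^ 2 / ρ ^ 2 by rw [e2]; ring]
      linarith
    have hα0 : 0 ≤ α₀ x := (sq_nonneg _).trans h1.1
    have hb := barrier_pos p δ (τ * m₀) x
    refine le_trans ?_ (le_of_le_of_eq (mul_le_mul_of_nonneg_left h6 (mul_pos hA0 hb).le)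
      (mul_assoc _ _ _))
    by_cases hx : x ∈ Metric.ball p η
    · rw [indicator_of_mem hx, mul_one]
      have hxη : ‖x - p‖ < η := by rwa [mem_ball_iff_norm] at hx
      have h9 : 1 ≤ A * barrier p δ (τ * m₀) x * (τ ^ 2 * (δ ^ 2 / ρ ^ 2)) := by
        have h10 : 1 ≤ Real.exp (τ * m₀ * (η + δ)) * barrier p δ (τ * m₀) x := by
          rw [barrier, ← Real.exp_add, Real.one_le_exp_iff]
          have : regDist p δ x ≤ η + δ := (regDist_le p hδ x).trans (by linarith)
          nlinarith [mul_le_mul_of_nonneg_left this (mul_pos hτ hm₀).le]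
        have h11 : 1 ≤ (η ^ 2 + δ ^ 2) / ρ ^ 2 := by
          rw [one_le_div (by positivity), hρ2]
          nlinarith [norm_nonneg (x - p)]
        have e3 : A * barrier p δ (τ * m₀) x * (τ ^ 2 * (δ ^ 2 / ρ ^ 2))
            = (Real.exp (τ * m₀ * (η + δ)) * barrier p δ (τ * m₀) x)
              * ((η ^ 2 + δ ^ 2) / ρ ^ 2) := by
          rw [hA]
          field_simp
        rw [e3]
        exact one_le_mul_of_one_le_of_one_le h10 h11
      nlinarith
    · rw [indicator_of_notMem hx, mul_zero]
      positivity
  filter_upwards [hnn, hs, Lp.coeFn_sub (A • toL2 s) (toL2 v), Lp.coeFn_smul A (toL2 s)]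
    with x h1 h2 h3 h4
  rw [toL2_sub, toL2_smul, h3, Pi.sub_apply, h4, Pi.smul_apply, h2, smul_eq_mul, sub_nonneg] at h1
  refine h1.trans ?_
  rw [hA, mul_assoc, barrier, ← Real.exp_add]
  refine mul_le_mul_of_nonneg_left (Real.exp_le_exp.2 ?_) (by positivity)
  nlinarith [mul_le_mul_of_nonneg_left (norm_le_regDist p δ x) (mul_pos hτ hm₀).le]

set_option maxHeartbeats 800000 in
/-- A pointwise lower bound by a subsolution centred at a point of the ball. -/
theorem exists_barrier_le (hm₀ : 0 < m₀) (hM₀ : 0 < M₀)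
    (hα₀ : ∀ᵐ x, m₀ ^ 2 ≤ α₀ x ∧ α₀ x ≤ M₀ ^ 2) {y : E n} (hy : y ∈ Metric.ball p η) {κ : ℝ}
    (hκ : M₀ < κ) {ε : ℝ} (hε : 0 < ε) :
    ∃ c > 0, ∀ᶠ τ : ℝ in atTop, ∀ v : H1 n, IsStationaryWave α₀ p η τ v →
      ∀ᵐ x, c / τ ^ 2 * Real.exp (-(τ * κ) * (‖x - y‖ + ε)) ≤ toL2 v x := by
  have hκ0 : 0 < κ := hM₀.trans hκ
  set r : ℝ := η - ‖y - p‖ with hr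
  have hr0 : 0 < r := by
    rw [mem_ball_iff_norm] at hy
    linarith
  have hin : ∀ x, ‖x - y‖ < r → x ∈ Metric.ball p η := fun x hx => by
    rw [mem_ball_iff_norm]
    calc ‖x - p‖ ≤ ‖x - y‖ + ‖y - p‖ := norm_sub_le_norm_sub_add_norm_sub _ _ _
      _ < η := by linarith
  -- The regularisation is so small that `κ²‖x - y‖²/ρ²` exceeds `M₀²` by a fixed margin, called `g`
  -- below, once `‖x - y‖ ≥ r`. This is where `κ > M₀` is needed.
  obtain ⟨δ, hδ0, hδε, hδ⟩ : ∃ δ : ℝ, 0 < δ ∧ δ ≤ ε ∧ M₀ ^ 2 * (r ^ 2 + δ ^ 2) < κ ^ 2 * r ^ 2 := by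
    have h1 : Tendsto (fun δ : ℝ => M₀ ^ 2 * (r ^ 2 + δ ^ 2)) (𝓝[>] 0)
        (𝓝 (M₀ ^ 2 * (r ^ 2 + 0 ^ 2))) :=
      (Continuous.tendsto (by fun_prop) _).mono_left nhdsWithin_le_nhds
    have h2 : M₀ ^ 2 * (r ^ 2 + 0 ^ 2) < κ ^ 2 * r ^ 2 := by
      have : M₀ ^ 2 < κ ^ 2 := by nlinarith
      nlinarith [pow_pos hr0 2]
    obtain ⟨δ, h3, h4, h5⟩ := ((h1.eventually_lt_const h2).and
      ((eventually_mem_nhdsWithin).and (eventually_nhdsWithin_of_eventually_nhds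
        (eventually_le_nhds hε)))).exists
    exact ⟨δ, h4, h5, h3⟩
  set g : ℝ := κ ^ 2 * (r ^ 2 / (r ^ 2 + δ ^ 2)) - M₀ ^ 2 with hg
  have hg0 : 0 < g := by
    rw [hg, sub_pos, ← mul_div_assoc, lt_div_iff₀ (by positivity)]
    exact hδ
  -- Near `y` the barrier's equation produces at most `τ²(M₀² + κn/δ)` for `τ ≥ 1`, while the source
  -- is at least `m₀²`; `c` is the ratio of these constants.
  set c : ℝ := m₀ ^ 2 / (M₀ ^ 2 + κ * n / δ) with hc
  have hden : 0 < M₀ ^ 2 + κ * n / δ := by positivity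
  have hc0 : 0 < c := by positivity
  refine ⟨c, hc0, ?_⟩
  -- The second threshold lets the margin `τ²g` beat the first-order term, which is at most `τκn/δ`.
  filter_upwards [eventually_ge_atTop 1, eventually_ge_atTop (κ * n / δ / g)] with τ hτ1 hτg v hv
  have hτ : 0 < τ := one_pos.trans_le hτ1
  have hτg' : κ * n / δ ≤ τ * g := by rwa [div_le_iff₀ hg0] at hτg
  obtain ⟨s, hs, hsf⟩ := exists_H1_barrier y hδ0 (mul_pos hτ hκ0)
  have hA0 : 0 < c / τ ^ 2 := by positivity
  have hnn : ∀ᵐ x, 0 ≤ toL2 (v - (c / τ ^ 2) • s) x := by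
    refine nonneg_of_energyForm_nonneg (c := m₀ ^ 2) (by positivity)
      (hα₀.mono fun x hx => hx.1) hτ.ne' fun φ hφ => ?_
    obtain ⟨hi, he⟩ := hsf α₀ τ φ
    rw [energyForm_sub_left, energyForm_smul_left, hv, he, inner_smul_LInf, sub_nonneg,
      ← integral_const_mul]
    refine integral_mono_ae (hi.const_mul _) (integrable_LInf_mul_mul _ _ _) ?_
    filter_upwards [hα₀, hφ, coeFn_ballIndicator p η] with x h1 h2 h3
    rw [h3, ← mul_assoc]
    refine mul_le_mul_of_nonneg_right ?_ h2
    set ρ := regDist y δ x with hρ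
    have hρ0 : 0 < ρ := regDist_pos y hδ0 x
    have hρ2 : ρ ^ 2 = ‖x - y‖ ^ 2 + δ ^ 2 := regDist_sq y δ x
    have hα0 : 0 ≤ α₀ x := (sq_nonneg _).trans h1.1
    have hb := barrier_pos y δ (τ * κ) x
    have h4 : τ * κ * ((n : ℝ) / ρ - ‖x - y‖ ^ 2 / ρ ^ 3) ≤ τ * (κ * n / δ) := by
      have h5 : (n : ℝ) / ρ ≤ n / δ :=
        div_le_div_of_nonneg_left (Nat.cast_nonneg n) hδ0 (le_regDist y δ x)
      have h6 : 0 ≤ ‖x - y‖ ^ 2 / ρ ^ 3 := by positivity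
      rw [mul_assoc, mul_div_assoc]
      refine mul_le_mul_of_nonneg_left (mul_le_mul_of_nonneg_left ?_ hκ0.le) hτ.le
      linarith
    have h7 : τ ^ 2 * α₀ x ≤ τ ^ 2 * M₀ ^ 2 := mul_le_mul_of_nonneg_left h1.2 (sq_nonneg τ)
    by_cases hx : ‖x - y‖ < r
    · rw [indicator_of_mem (hin x hx), mul_one]
      refine le_trans ?_ h1.1
      have h8 : barrier y δ (τ * κ) x ≤ 1 := by
        rw [barrier, Real.exp_le_one_iff, neg_mul, neg_nonpos]
        positivity
      have h9 : τ ^ 2 * α₀ x - (τ * κ) ^ 2 * (‖x - y‖ ^ 2 / ρ ^ 2)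
          + τ * κ * (n / ρ - ‖x - y‖ ^ 2 / ρ ^ 3) ≤ τ ^ 2 * (M₀ ^ 2 + κ * n / δ) := by
        have h10 : 0 ≤ (τ * κ) ^ 2 * (‖x - y‖ ^ 2 / ρ ^ 2) := by positivity
        have h11 : τ * (κ * n / δ) ≤ τ ^ 2 * (κ * n / δ) :=
          mul_le_mul_of_nonneg_right (by nlinarith) (by positivity)
        linarith
      have h12 : barrier y δ (τ * κ) x * (τ ^ 2 * α₀ x - (τ * κ) ^ 2 * (‖x - y‖ ^ 2 / ρ ^ 2)
          + τ * κ * (n / ρ - ‖x - y‖ ^ 2 / ρ ^ 3)) ≤ τ ^ 2 * (M₀ ^ 2 + κ * n / δ) :=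
        (mul_le_mul_of_nonneg_left h9 hb.le).trans
          (mul_le_of_le_one_left (by positivity) h8)
      calc _ ≤ c / τ ^ 2 * (τ ^ 2 * (M₀ ^ 2 + κ * n / δ)) :=
            mul_le_mul_of_nonneg_left h12 hA0.le
        _ = m₀ ^ 2 := by
          rw [hc]
          field_simp
    · push Not at hx
      have h8 : r ^ 2 / (r ^ 2 + δ ^ 2) ≤ ‖x - y‖ ^ 2 / ρ ^ 2 := by
        rw [hρ2, div_le_div_iff₀ (by positivity) (by positivity)]
        have : r ^ 2 ≤ ‖x - y‖ ^ 2 := pow_le_pow_left₀ hr0.le hx 2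
        nlinarith [mul_le_mul_of_nonneg_right this (sq_nonneg δ)]
      have h9 : τ ^ 2 * α₀ x - (τ * κ) ^ 2 * (‖x - y‖ ^ 2 / ρ ^ 2)
          + τ * κ * (n / ρ - ‖x - y‖ ^ 2 / ρ ^ 3) ≤ 0 := by
        have h10 := mul_le_mul_of_nonneg_left h8 (sq_nonneg (τ * κ))
        have h11 := mul_le_mul_of_nonneg_left hτg' hτ.le
        have e : τ * (τ * g) = (τ * κ) ^ 2 * (r ^ 2 / (r ^ 2 + δ ^ 2)) - τ ^ 2 * M₀ ^ 2 := by
          rw [hg]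
          ring
        linarith
      refine le_trans (mul_nonpos_of_nonneg_of_nonpos hA0.le
        (mul_nonpos_of_nonneg_of_nonpos hb.le h9)) ?_
      exact mul_nonneg hα0 (indicator_nonneg (fun _ _ => zero_le_one) _)
  filter_upwards [hnn, hs, Lp.coeFn_sub (toL2 v) ((c / τ ^ 2) • toL2 s),
    Lp.coeFn_smul (c / τ ^ 2) (toL2 s)] with x h1 h2 h3 h4
  rw [toL2_sub, toL2_smul, h3, Pi.sub_apply, h4, Pi.smul_apply, h2, smul_eq_mul, sub_nonneg] at h1
  refine le_trans ?_ h1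
  refine mul_le_mul_of_nonneg_left (Real.exp_le_exp.2 ?_) hA0.le
  have h5 : regDist y δ x ≤ ‖x - y‖ + ε := (regDist_le y hδ0 x).trans (by linarith)
  nlinarith [mul_le_mul_of_nonneg_left h5 (mul_pos hτ hκ0).le]

/-! ### The distance between the obstacle and the ball -/

theorem setDist_le {D B : Set (E n)} {x y : E n} (hx : x ∈ D) (hy : y ∈ B) :
    setDist D B ≤ dist x y :=
  csInf_le ⟨0, by rintro _ ⟨a, -, b, -, rfl⟩; exact dist_nonneg⟩ ⟨x, hx, y, hy, rfl⟩

theorem setDist_nonneg (D B : Set (E n)) : 0 ≤ setDist D B :=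
  Real.sInf_nonneg (by rintro _ ⟨a, -, b, -, rfl⟩; exact dist_nonneg)

theorem exists_dist_lt_setDist_add {D B : Set (E n)} (hD : D.Nonempty) (hB : B.Nonempty) {ε : ℝ}
    (hε : 0 < ε) : ∃ x ∈ D, ∃ y ∈ B, dist x y < setDist D B + ε := by
  obtain ⟨_, ⟨x, hx, y, hy, rfl⟩, h⟩ := Real.lt_sInf_add_pos (hD.image2 hB (f := dist)) hε
  exact ⟨x, hx, y, hy, h⟩

/-- Points of the segment from `p` to `x` at distance `s < η` from `p` lie in the ball, so the set
distance is at most `‖x - p‖ - s`; then `s → η`. It converts decay measured from the centre into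
decay measured from the ball. -/
theorem add_setDist_le {D : Set (E n)} (hη : 0 < η) (hdisj : Disjoint D (Metric.ball p η))
    {x : E n} (hx : x ∈ D) : η + setDist D (Metric.ball p η) ≤ ‖x - p‖ := by
  have hxB : η ≤ ‖x - p‖ := by
    by_contra hcon
    push Not at hcon
    exact hdisj.notMem_of_mem_left hx (mem_ball_iff_norm.2 hcon)
  have hr : 0 < ‖x - p‖ := hη.trans_le hxB
  rw [← le_sub_iff_add_le]
  refine le_of_forall_lt_imp_le_of_dense fun s hs => ?_
  rcases le_or_gt s 0 with hs0 | hs0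
  · have := setDist_le hx (Metric.mem_ball_self (x := p) hη)
    rw [dist_eq_norm] at this
    linarith
  have hy : p + (s / ‖x - p‖) • (x - p) ∈ Metric.ball p η := by
    rw [mem_ball_iff_norm, add_sub_cancel_left, norm_smul, Real.norm_of_nonneg (by positivity),
      div_mul_cancel₀ _ hr.ne']
    exact hs
  have h := setDist_le hx hy
  have e : x - (p + (s / ‖x - p‖) • (x - p)) = (1 - s / ‖x - p‖) • (x - p) := by
    rw [sub_smul, one_smul]
    abel
  rw [dist_eq_norm, e, norm_smul, Real.norm_of_nonneg (by
    rw [sub_nonneg, div_le_one hr]; linarith), sub_mul, div_mul_cancel₀ _ hr.ne', one_mul] at h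
  linarith

/-- The mass of the stationary wave on the obstacle is at most of order
`e^{-2 τ m₀ dist(D, B)}`. -/
theorem eventually_mass_le (hn : 1 ≤ n) (hm₀ : 0 < m₀)
    (hα₀ : ∀ᵐ x, m₀ ^ 2 ≤ α₀ x ∧ α₀ x ≤ M₀ ^ 2) (hη : 0 < η) {D : Set (E n)} (hDo : IsOpen D)
    (hDb : Bornology.IsBounded D) (hdisj : Disjoint D (Metric.ball p η)) {ε : ℝ} (hε : 0 < ε)
    {K : ℝ} (hK : 0 ≤ K) :
    ∀ᶠ τ : ℝ in atTop, ∀ v : H1 n, IsStationaryWave α₀ p η τ v →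
      K * (τ ^ 2 * ∫ x in D, toL2 v x * toL2 v x)
        ≤ Real.exp (-(2 * τ) * (m₀ * setDist D (Metric.ball p η) - ε)) := by
  set d := setDist D (Metric.ball p η) with hd
  -- Half of `ε` pays for the regularisation, since `m₀δ = ε/2`; the other half yields the factor
  -- `e^{τε}` that absorbs all constants.
  set δ := ε / (2 * m₀) with hδ
  have hδ0 : 0 < δ := by positivity
  set C := (η ^ 2 + δ ^ 2) / δ ^ 2 with hC
  have hC0 : 0 < C := by positivity
  have hlim : Tendsto (fun τ : ℝ => Real.exp (τ * ε)) atTop atTop :=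
    Real.tendsto_exp_atTop.comp (tendsto_id.atTop_mul_const hε)
  filter_upwards [eventually_ge_atTop 1,
    hlim.eventually_ge_atTop (K * (volume.real D * C ^ 2))] with τ hτ1 hτ2 v hv
  have hτ : 0 < τ := one_pos.trans_le hτ1
  set b := C / τ ^ 2 * Real.exp (-(τ * m₀) * (d - δ)) with hb
  have h1 : ∀ᵐ x ∂(volume.restrict D), ‖toL2 v x * toL2 v x‖ ≤ b ^ 2 := by
    filter_upwards [ae_restrict_of_ae (hv.nonneg hm₀ hα₀ hτ),
      ae_restrict_of_ae (hv.le_barrier hn hm₀ hα₀ hη hδ0 hτ),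
      ae_restrict_mem hDo.measurableSet] with x h2 h3 h4
    have h5 : toL2 v x ≤ b := by
      refine h3.trans ?_
      rw [hb, hC, div_div]
      refine mul_le_mul_of_nonneg_left (Real.exp_le_exp.2 ?_) (by positivity)
      have h6 := add_setDist_le hη hdisj h4
      have h7 : d - δ ≤ ‖x - p‖ - η - δ := by linarith
      have h8 := mul_le_mul_of_nonneg_left h7 (mul_pos hτ hm₀).le
      linarith
    rw [Real.norm_of_nonneg (mul_self_nonneg _), sq]
    exact mul_self_le_mul_self h2 h5
  have h2 : ∫ x in D, toL2 v x * toL2 v x ≤ b ^ 2 * volume.real D :=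
    (le_abs_self _).trans (norm_setIntegral_le_of_norm_le_const_ae hDb.measure_lt_top h1)
  have h3 : K * (τ ^ 2 * (b ^ 2 * volume.real D))
      = (K * (volume.real D * C ^ 2)) * Real.exp (-(2 * τ) * (m₀ * d - m₀ * δ)) / τ ^ 2 := by
    have : Real.exp (-(2 * τ) * (m₀ * d - m₀ * δ)) = Real.exp (-(τ * m₀) * (d - δ)) ^ 2 := by
      rw [← Real.exp_nat_mul]
      push_cast
      ring_nf
    rw [this, hb]
    field_simp
  have h4 : Real.exp (τ * ε) * Real.exp (-(2 * τ) * (m₀ * d - m₀ * δ))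
      = Real.exp (-(2 * τ) * (m₀ * d - ε)) := by
    rw [← Real.exp_add]
    congr 1
    rw [hδ]
    field_simp
    ring
  calc K * (τ ^ 2 * ∫ x in D, toL2 v x * toL2 v x)
      ≤ K * (τ ^ 2 * (b ^ 2 * volume.real D)) := by gcongr
    _ ≤ (K * (volume.real D * C ^ 2)) * Real.exp (-(2 * τ) * (m₀ * d - m₀ * δ)) := by
      rw [h3]
      exact div_le_self (by positivity) (by nlinarith)
    _ ≤ Real.exp (τ * ε) * Real.exp (-(2 * τ) * (m₀ * d - m₀ * δ)) := by gcongr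
    _ = _ := h4

/-- The mass of the stationary wave on the obstacle is at least of order
`e^{-2 τ M₀ dist(D, B)}`. -/
theorem eventually_le_mass (hm₀ : 0 < m₀) (hM₀ : 0 < M₀)
    (hα₀ : ∀ᵐ x, m₀ ^ 2 ≤ α₀ x ∧ α₀ x ≤ M₀ ^ 2) (hη : 0 < η) {D : Set (E n)} (hDo : IsOpen D)
    (hDn : D.Nonempty) {ε : ℝ} (hε : 0 < ε) {K : ℝ} (hK : 0 < K) :
    ∀ᶠ τ : ℝ in atTop, ∀ v : H1 n, IsStationaryWave α₀ p η τ v →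
      Real.exp (-(2 * τ) * (M₀ * setDist D (Metric.ball p η) + ε))
        ≤ K * (τ ^ 2 * ∫ x in D, toL2 v x * toL2 v x) := by
  set d := setDist D (Metric.ball p η) with hd
  have hd0 : 0 ≤ d := setDist_nonneg _ _
  -- The three `θ` in `d + 3θ` pay for the almost closest pair of points, the radius of the small
  -- ball in `D`, and the regularisation; `M₀ + θ` is the decay rate. The remaining `ε/2` absorbs
  -- the powers of `τ`.
  obtain ⟨θ, hθ0, hθ⟩ : ∃ θ : ℝ, 0 < θ ∧ (M₀ + θ) * (d + 3 * θ) < M₀ * d + ε / 2 := by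
    have h1 : Tendsto (fun θ : ℝ => (M₀ + θ) * (d + 3 * θ)) (𝓝[>] 0)
        (𝓝 ((M₀ + 0) * (d + 3 * 0))) :=
      (Continuous.tendsto (by fun_prop) _).mono_left nhdsWithin_le_nhds
    obtain ⟨θ, h2, h3⟩ := ((h1.eventually_lt_const (u := M₀ * d + ε / 2) (by linarith)).and
      eventually_mem_nhdsWithin).exists
    exact ⟨θ, h3, h2⟩
  obtain ⟨x₀, hx₀, y, hy, hxy⟩ :=
    exists_dist_lt_setDist_add hDn ⟨p, Metric.mem_ball_self (x := p) hη⟩ hθ0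
  obtain ⟨r, hr0, hr⟩ := Metric.isOpen_iff.1 hDo x₀ hx₀
  set G := Metric.ball x₀ (min r θ) with hG
  have hGD : G ⊆ D := (Metric.ball_subset_ball (min_le_left _ _)).trans hr
  have hGv : 0 < volume.real G := by
    rw [measureReal_def, ENNReal.toReal_pos_iff]
    exact ⟨Metric.measure_ball_pos _ _ (lt_min hr0 hθ0), measure_ball_lt_top⟩
  obtain ⟨c, hc, hev⟩ := exists_barrier_le hm₀ hM₀ hα₀ hy (lt_add_of_pos_right M₀ hθ0) hθ0
  have hlim : Tendsto (fun τ : ℝ => τ ^ 2 * Real.exp (-(ε * τ))) atTop (𝓝 0) := by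
    have h1 := (Real.tendsto_pow_mul_exp_neg_atTop_nhds_zero 2).comp
      (tendsto_id.const_mul_atTop hε)
    have h2 := h1.const_mul (1 / ε ^ 2)
    rw [mul_zero] at h2
    refine h2.congr fun τ => ?_
    simp only [Function.comp_apply, id]
    field_simp
  have hsmall : 0 < K * c ^ 2 * volume.real G := by positivity
  filter_upwards [hev, eventually_ge_atTop 1, hlim.eventually_lt_const hsmall]
    with τ hτv hτ1 hτ2 v hv
  have hτ : 0 < τ := one_pos.trans_le hτ1
  set b := c / τ ^ 2 * Real.exp (-(τ * (M₀ + θ)) * (d + 3 * θ)) with hb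
  have h1 : b ^ 2 * volume.real G ≤ ∫ x in D, toL2 v x * toL2 v x := by
    have h2 : b ^ 2 * volume.real G ≤ ∫ x in G, toL2 v x * toL2 v x := by
      have h3 : ∫ x in G, b ^ 2 = b ^ 2 * volume.real G := by
        rw [setIntegral_const, smul_eq_mul, mul_comm]
      rw [← h3]
      refine integral_mono_ae (integrableOn_const measure_ball_lt_top.ne)
        (integrable_mul_L2 _ _).integrableOn ?_
      filter_upwards [ae_restrict_of_ae (hτv v hv), ae_restrict_mem measurableSet_ball] with x h4 h5
      rw [sq]
      have h6 : b ≤ toL2 v x := by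
        refine le_trans (mul_le_mul_of_nonneg_left (Real.exp_le_exp.2 ?_) (by positivity)) h4
        have h7 : ‖x - y‖ ≤ d + 2 * θ := by
          have h8 := dist_triangle x x₀ y
          have h9 : dist x x₀ < θ := (Metric.mem_ball.1 h5).trans_le (min_le_right _ _)
          rw [← dist_eq_norm]
          linarith
        have h10 : ‖x - y‖ + θ ≤ d + 3 * θ := by linarith
        have h11 := mul_le_mul_of_nonneg_left h10 (by positivity : 0 ≤ τ * (M₀ + θ))
        linarith
      exact mul_self_le_mul_self (by positivity) h6
    refine h2.trans (setIntegral_mono_set (integrable_mul_L2 _ _).integrableOn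
      (Eventually.of_forall fun x => mul_self_nonneg _) hGD.eventuallyLE)
  refine le_trans ?_ (mul_le_mul_of_nonneg_left (mul_le_mul_of_nonneg_left h1 (sq_nonneg τ)) hK.le)
  have e1 : K * (τ ^ 2 * (b ^ 2 * volume.real G))
      = (K * c ^ 2 * volume.real G) * Real.exp (-(2 * τ) * ((M₀ + θ) * (d + 3 * θ))) / τ ^ 2 := by
    have : Real.exp (-(2 * τ) * ((M₀ + θ) * (d + 3 * θ)))
        = Real.exp (-(τ * (M₀ + θ)) * (d + 3 * θ)) ^ 2 := by
      rw [← Real.exp_nat_mul]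
      push_cast
      ring_nf
    rw [this, hb]
    field_simp
  rw [e1, le_div_iff₀ (by positivity)]
  calc Real.exp (-(2 * τ) * (M₀ * d + ε)) * τ ^ 2
      = (τ ^ 2 * Real.exp (-(ε * τ))) * Real.exp (-(2 * τ) * (M₀ * d + ε / 2)) := by
        rw [mul_assoc, ← Real.exp_add, mul_comm]
        ring_nf
    _ ≤ (K * c ^ 2 * volume.real G) * Real.exp (-(2 * τ) * ((M₀ + θ) * (d + 3 * θ))) := by
        refine mul_le_mul hτ2.le (Real.exp_le_exp.2 ?_) (Real.exp_pos _).le hsmall.le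
        nlinarith [mul_le_mul_of_nonneg_left hθ.le hτ.le]

end Bounds

/-! ### Exponential asymptotics -/

section Asymptotics

variable {I J : ℝ → ℝ} {T a b : ℝ}

theorem tendsto_exp_mul_abs_atTop (hT : 2 * a < T)
    (hlow : ∀ ε > 0, ∀ᶠ τ : ℝ in atTop, Real.exp (-(2 * τ) * (a + ε)) ≤ |J τ|) :
    Tendsto (fun τ => Real.exp (τ * T) * |J τ|) atTop atTop := by
  -- A quarter of the gap in `ε` leaves `T - 2(a + ε) = (T - 2a)/2 > 0` in the exponent.
  have hε : 0 < (T - 2 * a) / 4 := by linarith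
  have h1 : Tendsto (fun τ : ℝ => Real.exp (τ * ((T - 2 * a) / 2))) atTop atTop :=
    Real.tendsto_exp_atTop.comp (tendsto_id.atTop_mul_const (by linarith))
  refine tendsto_atTop_mono' _ ?_ h1
  filter_upwards [hlow _ hε] with τ hτ
  refine le_trans (le_of_eq ?_) (mul_le_mul_of_nonneg_left hτ (Real.exp_pos _).le)
  rw [← Real.exp_add]
  ring_nf

theorem tendsto_atTop_of_nonneg (hT : 2 * a < T)
    (hIJ : Tendsto (fun τ => Real.exp (τ * T) * (I τ - J τ)) atTop (𝓝 0))
    (hlow : ∀ ε > 0, ∀ᶠ τ : ℝ in atTop, Real.exp (-(2 * τ) * (a + ε)) ≤ |J τ|)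
    (hJ : ∀ᶠ τ in atTop, 0 ≤ J τ) :
    Tendsto (fun τ => Real.exp (τ * T) * I τ) atTop atTop := by
  refine ((tendsto_exp_mul_abs_atTop hT hlow).atTop_add hIJ).congr' ?_
  filter_upwards [hJ] with τ hτ
  rw [abs_of_nonneg hτ]
  ring

theorem tendsto_atBot_of_nonpos (hT : 2 * a < T)
    (hIJ : Tendsto (fun τ => Real.exp (τ * T) * (I τ - J τ)) atTop (𝓝 0))
    (hlow : ∀ ε > 0, ∀ᶠ τ : ℝ in atTop, Real.exp (-(2 * τ) * (a + ε)) ≤ |J τ|)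
    (hJ : ∀ᶠ τ in atTop, J τ ≤ 0) :
    Tendsto (fun τ => Real.exp (τ * T) * I τ) atTop atBot := by
  refine tendsto_neg_atTop_iff.1 ?_
  have h := tendsto_atTop_of_nonneg (I := fun τ => -I τ) (J := fun τ => -J τ) hT
    (by simpa [sub_eq_add_neg, add_comm, mul_add] using hIJ.neg) (by simpa using hlow)
    (hJ.mono fun τ hτ => neg_nonneg.2 hτ)
  simpa using h

/-- After multiplication by `e^{τT}` the difference `I - J` tends to zero while `|J|` tends to
infinity, so the relative error becomes less than one half. -/
theorem eventually_half_abs_le (hT : 2 * a < T)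
    (hIJ : Tendsto (fun τ => Real.exp (τ * T) * (I τ - J τ)) atTop (𝓝 0))
    (hlow : ∀ ε > 0, ∀ᶠ τ : ℝ in atTop, Real.exp (-(2 * τ) * (a + ε)) ≤ |J τ|) :
    ∀ᶠ τ in atTop, 0 < |J τ| ∧ |J τ| / 2 ≤ |I τ| ∧ |I τ| ≤ 2 * |J τ| := by
  have h1 : ∀ᶠ τ in atTop, |Real.exp (τ * T) * (I τ - J τ)| < 1 :=
    (by simpa using hIJ.abs : Tendsto _ atTop (𝓝 (0 : ℝ))).eventually_lt_const one_pos
  filter_upwards [h1, (tendsto_exp_mul_abs_atTop hT hlow).eventually_ge_atTop 2,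
    hlow 1 one_pos] with τ h2 h3 h4
  have hE := Real.exp_pos (τ * T)
  rw [abs_mul, abs_of_pos hE] at h2
  have h5 : |I τ - J τ| ≤ |J τ| / 2 := by
    refine le_of_mul_le_mul_left ?_ hE
    linarith
  have h6 := abs_sub_abs_le_abs_sub (J τ) (I τ)
  have h7 := abs_sub_abs_le_abs_sub (I τ) (J τ)
  rw [abs_sub_comm] at h6
  have h8 : 0 < |J τ| := (Real.exp_pos _).trans_le h4
  exact ⟨h8, by linarith, by linarith⟩

/-- Replacing `J` by `I` costs at most a factor `2`, that is `log 2/(2τ)` after normalisation, which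
vanishes in the limit. -/
theorem le_liminf_log (hT : 2 * a < T)
    (hIJ : Tendsto (fun τ => Real.exp (τ * T) * (I τ - J τ)) atTop (𝓝 0))
    (hlow : ∀ ε > 0, ∀ᶠ τ : ℝ in atTop, Real.exp (-(2 * τ) * (a + ε)) ≤ |J τ|) :
    ((-a : ℝ) : EReal) ≤
      liminf (fun τ : ℝ => ((1 / (2 * τ) * Real.log |I τ| : ℝ) : EReal)) atTop := by
  refine EReal.ge_of_forall_gt_iff_ge.1 fun z hz => ?_
  rw [EReal.coe_lt_coe_iff] at hz
  set ε := (-a - z) / 2 with hε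
  have hε0 : 0 < ε := by linarith
  refine le_liminf_of_le (by isBoundedDefault) ?_
  filter_upwards [eventually_half_abs_le hT hIJ hlow, hlow ε hε0, eventually_gt_atTop 0,
    eventually_ge_atTop (Real.log 2 / (2 * ε))] with τ h1 h2 hτ h3
  rw [EReal.coe_le_coe_iff, one_div, ← div_eq_inv_mul, le_div_iff₀ (by positivity)]
  rw [div_le_iff₀ (by positivity)] at h3
  have h4 : Real.log (Real.exp (-(2 * τ) * (a + ε)) / 2) ≤ Real.log |I τ| :=
    Real.log_le_log (by positivity) (by linarith [h1.2.1])
  rw [Real.log_div (Real.exp_pos _).ne' two_ne_zero, Real.log_exp] at h4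
  have : z = -a - 2 * ε := by rw [hε]; ring
  rw [this]
  linarith

theorem limsup_log_le (hT : 2 * a < T)
    (hIJ : Tendsto (fun τ => Real.exp (τ * T) * (I τ - J τ)) atTop (𝓝 0))
    (hlow : ∀ ε > 0, ∀ᶠ τ : ℝ in atTop, Real.exp (-(2 * τ) * (a + ε)) ≤ |J τ|)
    (hup : ∀ ε > 0, ∀ᶠ τ : ℝ in atTop, |J τ| ≤ Real.exp (-(2 * τ) * (b - ε))) :
    limsup (fun τ : ℝ => ((1 / (2 * τ) * Real.log |I τ| : ℝ) : EReal)) atTop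
      ≤ ((-b : ℝ) : EReal) := by
  refine EReal.le_of_forall_lt_iff_le.1 fun z hz => ?_
  rw [EReal.coe_lt_coe_iff] at hz
  set ε := (z + b) / 2 with hε
  have hε0 : 0 < ε := by linarith
  refine limsup_le_of_le (by isBoundedDefault) ?_
  filter_upwards [eventually_half_abs_le hT hIJ hlow, hup ε hε0, eventually_gt_atTop 0,
    eventually_ge_atTop (Real.log 2 / (2 * ε))] with τ h1 h2 hτ h3
  rw [EReal.coe_le_coe_iff, one_div, ← div_eq_inv_mul, div_le_iff₀ (by positivity)]
  rw [div_le_iff₀ (by positivity)] at h3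
  have h4 : Real.log |I τ| ≤ Real.log (2 * Real.exp (-(2 * τ) * (b - ε))) :=
    Real.log_le_log (by linarith [h1.1, h1.2.1]) (by linarith [h1.2.2])
  rw [Real.log_mul two_ne_zero (Real.exp_pos _).ne', Real.log_exp] at h4
  have : z = -b + 2 * ε := by rw [hε]; ring
  rw [this]
  linarith

end Asymptotics

/-! ### Sign and size of the indicator function for the obstacle -/

section Indicator

variable {n : ℕ} {α₀ α : LInf n} {m₀ M₀ : ℝ} {D : Set (E n)} {p : E n} {η T : ℝ}
  {u : ℝ → H1 n} {Ve : ℝ → L2Ball p η}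

theorem ae_abs_le_norm (β : LInf n) : ∀ᵐ x, |β x| ≤ ‖β‖ := by
  filter_upwards [ae_le_eLpNormEssSup (f := β) (μ := (volume : Measure (E n)))] with x hx
  rw [Lp.norm_def, ← Real.norm_eq_abs, ← toReal_enorm, eLpNorm_exponent_top]
  refine ENNReal.toReal_mono ?_ hx
  rw [← eLpNorm_exponent_top]
  exact (Lp.memLp β).eLpNorm_ne_top

/-- The media differ only on `D`, which misses the ball. Hence both stationary problems share one
source, and `J` involves only the difference of their solutions. -/
theorem smul_ballIndicator_eq (hD : MeasurableSet D) (hdisj : Disjoint D (Metric.ball p η))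
    (hout : ∀ᵐ x ∂(volume.restrict Dᶜ), α x = α₀ x) :
    (α • ballIndicator p η : L2 n) = α₀ • ballIndicator p η := by
  rw [ae_restrict_iff' hD.compl] at hout
  refine Lp.ext ?_
  filter_upwards [hout, coeFn_smul_LInf α (ballIndicator p η),
    coeFn_smul_LInf α₀ (ballIndicator p η), coeFn_ballIndicator p η] with x h1 h2 h3 h4
  rw [h2, h3, h4]
  by_cases hx : x ∈ D
  · rw [indicator_of_notMem (hdisj.notMem_of_mem_left hx), mul_zero, mul_zero]
  · rw [h1 hx]

/-- Comparison of the indicator function with its stationary counterpart. -/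
theorem exists_stationary (hm₀ : 0 < m₀) (hα₀ : ∀ᵐ x, m₀ ^ 2 ≤ α₀ x ∧ α₀ x ≤ M₀ ^ 2)
    (hα : ∃ c > 0, ∀ᵐ x, c ≤ α x) (hD : MeasurableSet D) (hdisj : Disjoint D (Metric.ball p η))
    (hout : ∀ᵐ x ∂(volume.restrict Dᶜ), α x = α₀ x) (hT : 0 < T)
    (hu : IsWeakSolution α (ballIndicator p η) T u) (hVe : IsReferenceWave α₀ p η T Ve) :
    ∃ v w : ℝ → H1 n, (∀ τ > 0, IsStationaryWave α₀ p η τ (v τ)) ∧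
      (∀ τ > 0, ∀ φ : H1 n,
        energyForm α τ (w τ) φ = inner ℝ (α₀ • ballIndicator p η : L2 n) (toL2 φ)) ∧
      Tendsto (fun τ : ℝ => Real.exp (τ * T) * (indicatorFunction α₀ p η T u Ve τ
        - inner ℝ (α₀ • ballIndicator p η : L2 n) (toL2 (w τ) - toL2 (v τ)))) atTop (𝓝 0) := by
  obtain ⟨c, hc, hα⟩ := hα
  have hm2 : 0 < m₀ ^ 2 := by positivity
  have hα₀' : ∀ᵐ x, m₀ ^ 2 ≤ α₀ x := hα₀.mono fun x hx => hx.1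
  -- For `τ ≤ 0` the value is arbitrary; a total function of `τ` is needed only to state limits.
  have hv : ∀ τ : ℝ, ∃ v : H1 n, 0 < τ → IsStationaryWave α₀ p η τ v := fun τ => by
    by_cases hτ : 0 < τ
    · obtain ⟨v, hv⟩ := exists_energyForm_eq hm2 hα₀' hτ.ne' (α₀ • ballIndicator p η : L2 n)
      exact ⟨v, fun _ => hv⟩
    · exact ⟨0, fun h => absurd h hτ⟩
  have hw : ∀ τ : ℝ, ∃ w : H1 n, 0 < τ → ∀ φ : H1 n,
      energyForm α τ w φ = inner ℝ (α₀ • ballIndicator p η : L2 n) (toL2 φ) := fun τ => by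
    by_cases hτ : 0 < τ
    · obtain ⟨w, hw⟩ := exists_energyForm_eq hc hα hτ.ne' (α₀ • ballIndicator p η : L2 n)
      exact ⟨w, fun _ => hw⟩
    · exact ⟨0, fun h => absurd h hτ⟩
  choose v hv using hv
  choose w hw using hw
  refine ⟨v, w, hv, hw, ?_⟩
  exact tendsto_exp_mul_indicatorFunction_sub (lt_min hm2 hc)
    (hα₀'.mono fun x hx => (min_le_left _ _).trans hx)
    (hα.mono fun x hx => (min_le_right _ _).trans hx) hT
    (smul_ballIndicator_eq hD hdisj hout) hu hVe hv hw

/-- The sign and the size of the stationary indicator when the medium jumps on `D`. -/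
theorem eventually_le_stationary (hm₀ : 0 < m₀) (hM₀ : 0 < M₀)
    (hα₀ : ∀ᵐ x, m₀ ^ 2 ≤ α₀ x ∧ α₀ x ≤ M₀ ^ 2) (hα : ∃ c > 0, ∀ᵐ x, c ≤ α x)
    (hDo : IsOpen D) (hDn : D.Nonempty) (hη : 0 < η)
    (hout : ∀ᵐ x ∂(volume.restrict Dᶜ), α x = α₀ x) {v w : ℝ → H1 n}
    (hv : ∀ τ > 0, IsStationaryWave α₀ p η τ (v τ))
    (hw : ∀ τ > 0, ∀ φ : H1 n,
      energyForm α τ (w τ) φ = inner ℝ (α₀ • ballIndicator p η : L2 n) (toL2 φ)) :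
    ((∃ C > 0, ∀ᵐ x ∂(volume.restrict D), C ≤ α x - α₀ x) → ∀ ε > 0, ∀ᶠ τ : ℝ in atTop,
      Real.exp (-(2 * τ) * (M₀ * setDist D (Metric.ball p η) + ε))
        ≤ -inner ℝ (α₀ • ballIndicator p η : L2 n) (toL2 (w τ) - toL2 (v τ))) ∧
    ((∃ C > 0, ∀ᵐ x ∂(volume.restrict D), C ≤ -(α x - α₀ x)) → ∀ ε > 0, ∀ᶠ τ : ℝ in atTop,
      Real.exp (-(2 * τ) * (M₀ * setDist D (Metric.ball p η) + ε))
        ≤ inner ℝ (α₀ • ballIndicator p η : L2 n) (toL2 (w τ) - toL2 (v τ))) := by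
  constructor
  · rintro ⟨C, hC, hin⟩ ε hε
    have hK : 0 < m₀ ^ 2 * C / (m₀ ^ 2 + C) := by positivity
    filter_upwards [eventually_le_mass hm₀ hM₀ hα₀ hη hDo hDn hε hK, eventually_gt_atTop 0]
      with τ h1 hτ
    exact (h1 _ (hv τ hτ)).trans (inner_le_of_le hDo.measurableSet hout (by positivity)
      (hα₀.mono fun x hx => hx.1) (hv τ hτ) (hw τ hτ) hC hin)
  · rintro ⟨C, hC, hin⟩ ε hε
    obtain ⟨c, hc, hα⟩ := hα
    filter_upwards [eventually_le_mass hm₀ hM₀ hα₀ hη hDo hDn hε hC, eventually_gt_atTop 0]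
      with τ h1 hτ
    exact (h1 _ (hv τ hτ)).trans (le_inner_of_le_neg hDo.measurableSet hout hc hα
      (hv τ hτ) (hw τ hτ) hin)

theorem eventually_abs_stationary_le (hn : 1 ≤ n) (hm₀ : 0 < m₀)
    (hα₀ : ∀ᵐ x, m₀ ^ 2 ≤ α₀ x ∧ α₀ x ≤ M₀ ^ 2) (hα : ∃ c > 0, ∀ᵐ x, c ≤ α x)
    (hDo : IsOpen D) (hDb : Bornology.IsBounded D) (hη : 0 < η)
    (hdisj : Disjoint D (Metric.ball p η))
    (hout : ∀ᵐ x ∂(volume.restrict Dᶜ), α x = α₀ x) {v w : ℝ → H1 n}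
    (hv : ∀ τ > 0, IsStationaryWave α₀ p η τ (v τ))
    (hw : ∀ τ > 0, ∀ φ : H1 n,
      energyForm α τ (w τ) φ = inner ℝ (α₀ • ballIndicator p η : L2 n) (toL2 φ)) {ε : ℝ}
    (hε : 0 < ε) : ∀ᶠ τ : ℝ in atTop,
      |inner ℝ (α₀ • ballIndicator p η : L2 n) (toL2 (w τ) - toL2 (v τ))|
        ≤ Real.exp (-(2 * τ) * (m₀ * setDist D (Metric.ball p η) - ε)) := by
  obtain ⟨c, hc, hα⟩ := hα
  have hin : ∀ᵐ x ∂(volume.restrict D), |α x - α₀ x| ≤ ‖α‖ + ‖α₀‖ := by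
    filter_upwards [ae_restrict_of_ae (ae_abs_le_norm α),
      ae_restrict_of_ae (ae_abs_le_norm α₀)] with x h1 h2
    exact (abs_sub _ _).trans (add_le_add h1 h2)
  filter_upwards [eventually_mass_le hn hm₀ hα₀ hη hDo hDb hdisj hε
    (K := (‖α‖ + ‖α₀‖) ^ 2 / c + (‖α‖ + ‖α₀‖)) (by positivity), eventually_gt_atTop 0]
    with τ h1 hτ
  exact (abs_inner_le hDo.measurableSet hout hc hα (hv τ hτ) (hw τ hτ) hin).trans
    (h1 _ (hv τ hτ))

end Indicator

end RoughWave

end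

theorem theorem5p1 {n : ℕ} (hn : n = 1 ∨ n = 3)
    -- the background medium
    (α₀ : LInf n) (m₀ M₀ : ℝ) (hm₀ : 0 < m₀) (hM₀ : 0 < M₀)
    (hα₀ : ∀ᵐ x ∂(volume : Measure (E n)), m₀ ^ 2 ≤ α₀ x ∧ α₀ x ≤ M₀ ^ 2)
    -- the obstacle
    (D : Set (E n)) (hDopen : IsOpen D) (hDbdd : Bornology.IsBounded D)
    (hDlip : HasLipschitzBoundary D)
    (h : Lp ℝ ∞ ((volume : Measure (E n)).restrict D))
    -- the medium with the obstacle
    (α : LInf n) (hα_pos : ∃ c > 0, ∀ᵐ x ∂(volume : Measure (E n)), c ≤ α x)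
    (hα_out : ∀ᵐ x ∂((volume : Measure (E n)).restrict Dᶜ), α x = α₀ x)
    (hα_in : ∀ᵐ x ∂((volume : Measure (E n)).restrict D), α x = α₀ x + h x)
    -- the ball where the waves are generated and observed
    (p : E n) (η : ℝ) (hη : 0 < η)
    (hBD : closure (Metric.ball p η) ∩ closure D = ∅) :
    (D = ∅ → ∀ T > 0, ∀ (u : ℝ → H1 n) (Ve : ℝ → L2Ball p η),
      IsWeakSolution α (ballIndicator p η) T u → IsReferenceWave α₀ p η T Ve →
      Tendsto (fun τ : ℝ => Real.exp (τ * T) * indicatorFunction α₀ p η T u Ve τ)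
        atTop (𝓝 0)) ∧
    (D.Nonempty →
      (∃ C > 0, ∀ᵐ x ∂((volume : Measure (E n)).restrict D), C ≤ h x) →
      ∀ T > 2 * M₀ * setDist D (Metric.ball p η), ∀ (u : ℝ → H1 n) (Ve : ℝ → L2Ball p η),
      IsWeakSolution α (ballIndicator p η) T u → IsReferenceWave α₀ p η T Ve →
      Tendsto (fun τ : ℝ => Real.exp (τ * T) * indicatorFunction α₀ p η T u Ve τ)
        atTop atBot) ∧
    (D.Nonempty →
      (∃ C > 0, ∀ᵐ x ∂((volume : Measure (E n)).restrict D), C ≤ - h x) →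
      ∀ T > 2 * M₀ * setDist D (Metric.ball p η), ∀ (u : ℝ → H1 n) (Ve : ℝ → L2Ball p η),
      IsWeakSolution α (ballIndicator p η) T u → IsReferenceWave α₀ p η T Ve →
      Tendsto (fun τ : ℝ => Real.exp (τ * T) * indicatorFunction α₀ p η T u Ve τ)
        atTop atTop) ∧
    (D.Nonempty →
      ((∃ C > 0, ∀ᵐ x ∂((volume : Measure (E n)).restrict D), C ≤ h x) ∨
        (∃ C > 0, ∀ᵐ x ∂((volume : Measure (E n)).restrict D), C ≤ - h x)) →
      ∀ T > 2 * M₀ * setDist D (Metric.ball p η), ∀ (u : ℝ → H1 n) (Ve : ℝ → L2Ball p η),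
      IsWeakSolution α (ballIndicator p η) T u → IsReferenceWave α₀ p η T Ve →
      ((-(M₀ * setDist D (Metric.ball p η)) : ℝ) : EReal) ≤
          liminf (fun τ : ℝ =>
            ((1 / (2 * τ) * Real.log |indicatorFunction α₀ p η T u Ve τ| : ℝ) : EReal)) atTop ∧
        limsup (fun τ : ℝ =>
            ((1 / (2 * τ) * Real.log |indicatorFunction α₀ p η T u Ve τ| : ℝ) : EReal)) atTop ≤
          ((-(m₀ * setDist D (Metric.ball p η)) : ℝ) : EReal)) := by
  have hn1 : 1 ≤ n := by rcases hn with rfl | rfl <;> norm_num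
  have hdisj : Disjoint D (Metric.ball p η) := by
    rw [Set.disjoint_iff_inter_eq_empty, Set.inter_comm, Set.eq_empty_iff_forall_notMem]
    intro x hx
    have : x ∈ closure (Metric.ball p η) ∩ closure D :=
      ⟨subset_closure hx.1, subset_closure hx.2⟩
    rwa [hBD] at this
  have hd := setDist_nonneg D (Metric.ball p η)
  have hpos : ∀ T > 2 * M₀ * setDist D (Metric.ball p η), 0 < T := fun T hT =>
    lt_of_le_of_lt (by positivity) hT
  have hsub : ∀ᵐ x ∂(volume.restrict D), α x - α₀ x = h x := by
    filter_upwards [hα_in] with x hx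
    rw [hx, add_sub_cancel_left]
  have hI : (∃ C > 0, ∀ᵐ x ∂((volume : Measure (E n)).restrict D), C ≤ h x) →
      ∃ C > 0, ∀ᵐ x ∂(volume.restrict D), C ≤ α x - α₀ x := by
    rintro ⟨C, hC, hCh⟩
    refine ⟨C, hC, ?_⟩
    filter_upwards [hCh, hsub] with x h1 h2
    rwa [h2]
  have hII : (∃ C > 0, ∀ᵐ x ∂((volume : Measure (E n)).restrict D), C ≤ -h x) →
      ∃ C > 0, ∀ᵐ x ∂(volume.restrict D), C ≤ -(α x - α₀ x) := by
    rintro ⟨C, hC, hCh⟩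
    refine ⟨C, hC, ?_⟩
    filter_upwards [hCh, hsub] with x h1 h2
    rwa [h2]
  refine ⟨?_, ?_, ?_, ?_⟩
  · intro hDe T hT u Ve hu hVe
    obtain ⟨v, w, hv, hw, hlim⟩ := exists_stationary hm₀ hα₀ hα_pos hDopen.measurableSet hdisj
      hα_out hT hu hVe
    obtain ⟨c, hc, hα⟩ := hα_pos
    refine hlim.congr' ?_
    filter_upwards [eventually_gt_atTop 0] with τ hτ
    -- With `D` empty the bound on the jump holds vacuously with `K = 0`, so the stationary
    -- indicator vanishes and only the `o(e^{-τT})` error remains.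
    have h1 := abs_inner_le hDopen.measurableSet hα_out hc hα (hv τ hτ) (hw τ hτ) (K := 0)
      (by rw [hDe, Measure.restrict_empty]; simp)
    rw [hDe, Measure.restrict_empty, integral_zero_measure, mul_zero, mul_zero] at h1
    rw [abs_nonpos_iff.1 h1, sub_zero]
  · intro hDn hA T hT u Ve hu hVe
    obtain ⟨v, w, hv, hw, hlim⟩ := exists_stationary hm₀ hα₀ hα_pos hDopen.measurableSet hdisj
      hα_out (hpos T hT) hu hVe
    have h1 := (eventually_le_stationary hm₀ hM₀ hα₀ hα_pos hDopen hDn hη hα_out hv hw).1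
      (hI hA)
    refine tendsto_atBot_of_nonpos (a := M₀ * setDist D (Metric.ball p η)) (by linarith) hlim
      (fun ε hε => (h1 ε hε).mono fun τ hτ => hτ.trans (neg_le_abs _)) ?_
    filter_upwards [h1 1 one_pos] with τ hτ
    linarith [Real.exp_pos (-(2 * τ) * (M₀ * setDist D (Metric.ball p η) + 1))]
  · intro hDn hA T hT u Ve hu hVe
    obtain ⟨v, w, hv, hw, hlim⟩ := exists_stationary hm₀ hα₀ hα_pos hDopen.measurableSet hdisj
      hα_out (hpos T hT) hu hVe
    have h1 := (eventually_le_stationary hm₀ hM₀ hα₀ hα_pos hDopen hDn hη hα_out hv hw).2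
      (hII hA)
    refine tendsto_atTop_of_nonneg (a := M₀ * setDist D (Metric.ball p η)) (by linarith) hlim
      (fun ε hε => (h1 ε hε).mono fun τ hτ => hτ.trans (le_abs_self _)) ?_
    filter_upwards [h1 1 one_pos] with τ hτ
    exact (Real.exp_pos _).le.trans hτ
  · intro hDn hA T hT u Ve hu hVe
    obtain ⟨v, w, hv, hw, hlim⟩ := exists_stationary hm₀ hα₀ hα_pos hDopen.measurableSet hdisj
      hα_out (hpos T hT) hu hVe
    have h1 := eventually_le_stationary hm₀ hM₀ hα₀ hα_pos hDopen hDn hη hα_out hv hw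
    have hlow : ∀ ε > 0, ∀ᶠ τ : ℝ in atTop,
        Real.exp (-(2 * τ) * (M₀ * setDist D (Metric.ball p η) + ε))
          ≤ |inner ℝ (α₀ • ballIndicator p η : L2 n) (toL2 (w τ) - toL2 (v τ))| := by
      intro ε hε
      rcases hA with hA | hA
      · exact (h1.1 (hI hA) ε hε).mono fun τ hτ => hτ.trans (neg_le_abs _)
      · exact (h1.2 (hII hA) ε hε).mono fun τ hτ => hτ.trans (le_abs_self _)
    have hT' : 2 * (M₀ * setDist D (Metric.ball p η)) < T := by linarith
    exact ⟨le_liminf_log hT' hlim hlow, limsup_log_le hT' hlim hlow fun ε hε =>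
      eventually_abs_stationary_le hn1 hm₀ hα₀ hα_pos hDopen hDbdd hη hdisj hα_out hv hw hε⟩
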